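/- Let $k$ be a field of characteristic $p>2$ and let $n\ge 1$. Let $$A_n(k)=k\langle x_1,\dots,x_{2n}\rangle/\bigl([x_i,x_j]=\delta_{i,j+n}-\delta_{i+n,j}\bigr)_{i,j}$$ be the Weyl algebra. The elements $x_i^p$ are central, and $z_i\mapsto x_i^p$ defines an isomorphism from the polynomial ring $k[z_1,\dots,z_{2n}]$ onto the center $Z_n(k)$ of $A_n(k)$. Put $\mathbb{A}^{2n}_k=\mathrm{Spec}(Z_n(k))$. The algebra $A_n(k)$ is Azumaya over $Z_n(k)$. For $R$ commutative, the Brauer group $\mathrm{Br}(\mathrm{Spec}\,R)$ is the set of Azumaya $R$-algebras modulo the relation: $A\sim B$ if and only if $A\otimes_R\mathrm{End}_R(V)\cong B\otimes_R\mathrm{End}_R(W)$ as $R$-algebras for some finitely generated projective faithful $R$-modules $V,W$. Its product is $[A]\cdot[B]=[A\otimes_R B]$. For $c\in k^\times$ let $\bar\omega(c)$ be the $k$-algebra automorphism of $Z_n(k)$ with $\bar\omega(c)(x_i^p)=x_i^p$ for $i\le n$ and $\bar\omega(c)(x_i^p)=c^{-1}x_i^p$ for $i>n$. Let $\omega(c)_*A_n(k)$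 be the ring $A_n(k)$ with the $Z_n(k)$-algebra structure $Z_n(k)\xrightarrow{\bar\omega(c)}Z_n(k)\to A_n(k)$, which is again Azumaya. By convention $\omega(0)_*A_n(k)$ is the matrix algebra $M_{p^n}(Z_n(k))$. Then for all $c,c'\in k$, $$[\omega(c)_*A_n(k)]\cdot[\omega(c')_*A_n(k)]=[\omega(c+c')_*A_n(k)]\quad\text{in }\mathrm{Br}(\mathbb{A}^{2n}_k).$$ Furthermore, the class $[A_n(k)]$ has order exactly $p$ in $\mathrm{Br}(\mathbb{A}^{2n}_k)$. -/

import Mathlib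

open scoped TensorProduct

universe u

noncomputable section

namespace WeylBrauer

/-! ### The Brauer group of a commutative ring -/

section Brauer

variable (R : Type u) [CommRing R]

/-- The canonical isomorphism `End V ⊗ End W ≅ End (V ⊗ W)` for finitely generated projective
modules. -/
def endTensorEquiv (V W : Type u) [AddCommGroup V] [Module R V] [Module.Finite R V]
    [Module.Projective R V] [AddCommGroup W] [Module R W] [Module.Finite R W]
    [Module.Projective R W] :
    Module.End R V ⊗[R] Module.End R W ≃ₐ[R] Module.End R (V ⊗[R] W) :=
  AlgEquiv.ofBijective
    (Module.endTensorEndAlgHom (R := R) (S := R) (A := R) (M := V) (N := W)) (by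
      have h : ⇑(Module.endTensorEndAlgHom (R := R) (S := R) (A := R) (M := V) (N := W))
          = ⇑(homTensorHomEquiv R V W V W) := by
        funext x
        rw [homTensorHomEquiv_apply]
        rfl
      rw [h]
      exact (homTensorHomEquiv R V W V W).bijective)

theorem faithful_tensor (V W : Type u) [AddCommGroup V] [Module R V]
    [Module.Projective R V] [FaithfulSMul R V] [AddCommGroup W] [Module R W]
    [FaithfulSMul R W] : FaithfulSMul R (V ⊗[R] W) := by
  have key : ∀ r : R, (∀ x : V ⊗[R] W, r • x = 0) → r = 0 := by
    intro r hr
    have h0 : ∀ v : V, r • v = 0 := by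
      intro v
      rw [← Module.forall_dual_apply_eq_zero_iff R]
      intro f
      refine FaithfulSMul.eq_of_smul_eq_smul (M := R) (α := W) fun w => ?_
      have h1 := congrArg (TensorProduct.lift ((LinearMap.lsmul R W).comp f)) (hr (v ⊗ₜ[R] w))
      simpa [smul_smul] using h1
    refine FaithfulSMul.eq_of_smul_eq_smul (M := R) (α := V) fun v => ?_
    rw [h0, zero_smul]
  refine ⟨fun {a b} h => sub_eq_zero.1 (key _ fun x => ?_)⟩
  rw [sub_smul, h, sub_self]

theorem isAzumaya_tensor (A B : Type u) [Ring A] [Algebra R A] [Ring B] [Algebra R B]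
    [IsAzumaya R A] [IsAzumaya R B] : IsAzumaya R (A ⊗[R] B) := by
  have := faithful_tensor R A B
  refine ⟨?_⟩
  let e₁ : (A ⊗[R] B) ⊗[R] (A ⊗[R] B)ᵐᵒᵖ ≃ₐ[R] (A ⊗[R] Aᵐᵒᵖ) ⊗[R] (B ⊗[R] Bᵐᵒᵖ) :=
    (Algebra.TensorProduct.congr AlgEquiv.refl
      (Algebra.TensorProduct.opAlgEquiv R R A B).symm).trans
      (Algebra.TensorProduct.tensorTensorTensorComm R R R R A B Aᵐᵒᵖ Bᵐᵒᵖ)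
  let e₂ := Algebra.TensorProduct.congr
      (AlgEquiv.ofBijective (AlgHom.mulLeftRight R A) IsAzumaya.bij)
      (AlgEquiv.ofBijective (AlgHom.mulLeftRight R B) IsAzumaya.bij)
  let e := (e₁.trans e₂).trans (endTensorEquiv R A B)
  have h : (AlgHom.mulLeftRight R (A ⊗[R] B)) = e.toAlgHom := by
    refine AlgHom.toLinearMap_injective ?_
    refine TensorProduct.ext' fun x y => ?_
    obtain ⟨y, rfl⟩ := MulOpposite.op_surjective y
    refine LinearMap.ext fun z => ?_
    induction x with
    | zero => simp
    | add x x' hx hx' => simp only [TensorProduct.add_tmul, map_add, LinearMap.add_apply, hx, hx']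
    | tmul a b =>
      induction y with
      | zero => simp
      | add y y' hy hy' =>
        simp only [MulOpposite.op_add, TensorProduct.tmul_add, map_add, LinearMap.add_apply, hy, hy']
      | tmul a' b' =>
        induction z with
        | zero => simp
        | add z z' hz hz' => simp only [map_add, hz, hz']
        | tmul a'' b'' =>
          simp [e, e₁, e₂, endTensorEquiv, Module.endTensorEndAlgHom_apply]
  rw [h]
  exact e.bijective

theorem isAzumaya_op (A : Type u) [Ring A] [Algebra R A] [IsAzumaya R A] :
    IsAzumaya R Aᵐᵒᵖ := by
  have : Module.Projective R Aᵐᵒᵖ := .of_equiv (MulOpposite.opLinearEquiv R (M := A))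
  have : Module.Finite R Aᵐᵒᵖ := .equiv (MulOpposite.opLinearEquiv R (M := A))
  have : FaithfulSMul R Aᵐᵒᵖ := .of_injective (MulOpposite.opLinearEquiv R (M := A))
    (MulOpposite.opLinearEquiv R (M := A)).injective
  refine ⟨?_⟩
  let e₁ : Aᵐᵒᵖ ⊗[R] Aᵐᵒᵖᵐᵒᵖ ≃ₐ[R] A ⊗[R] Aᵐᵒᵖ :=
    (Algebra.TensorProduct.congr AlgEquiv.refl (AlgEquiv.opOp R A).symm).trans
      (Algebra.TensorProduct.comm R Aᵐᵒᵖ A)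
  let e := (e₁.trans (AlgEquiv.ofBijective (AlgHom.mulLeftRight R A) IsAzumaya.bij)).trans
    ((MulOpposite.opLinearEquiv R (M := A)).conjAlgEquiv R)
  have h : (AlgHom.mulLeftRight R Aᵐᵒᵖ) = e.toAlgHom := by
    refine AlgHom.toLinearMap_injective ?_
    refine TensorProduct.ext' fun x y => ?_
    refine LinearMap.ext fun z => ?_
    obtain ⟨x, rfl⟩ := MulOpposite.op_surjective x
    obtain ⟨y, rfl⟩ := MulOpposite.op_surjective y
    obtain ⟨y, rfl⟩ := MulOpposite.op_surjective y
    obtain ⟨z, rfl⟩ := MulOpposite.op_surjective z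
    apply MulOpposite.unop_injective
    simp [e, e₁, mul_assoc]
  rw [h]
  exact e.bijective

/-- An Azumaya algebra over `R`. -/
structure AzumayaAlgebra where
  carrier : Type u
  [ring : Ring carrier]
  [algebra : Algebra R carrier]
  [isAzumaya : IsAzumaya R carrier]

attribute [instance] AzumayaAlgebra.ring AzumayaAlgebra.algebra AzumayaAlgebra.isAzumaya

/-- A finitely generated projective faithful `R`-module. (Faithfulness, i.e. everywhere positive
rank, excludes the zero endomorphism algebra in the definition of Brauer equivalence.) -/
structure Progenerator where
  carrier : Type u
  [addCommGroup : AddCommGroup carrier]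
  [module : Module R carrier]
  [finite : Module.Finite R carrier]
  [projective : Module.Projective R carrier]
  [faithful : FaithfulSMul R carrier]

attribute [instance] Progenerator.addCommGroup Progenerator.module Progenerator.finite
  Progenerator.projective Progenerator.faithful

variable {R}

/-- The tensor product of two progenerators. -/
def Progenerator.tensor (V W : Progenerator R) : Progenerator R :=
  have := faithful_tensor R V.carrier W.carrier
  ⟨V.carrier ⊗[R] W.carrier⟩

/-- The free module of rank one. -/
def Progenerator.unit : Progenerator R := ⟨R⟩

/-- The underlying module of an Azumaya algebra. -/
def AzumayaAlgebra.toProgenerator (A : AzumayaAlgebra R) : Progenerator R := ⟨A.carrier⟩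

/-- Brauer equivalence: `A ⊗ End V ≅ B ⊗ End W` as `R`-algebras, for some finitely generated
projective faithful `R`-modules `V` and `W`. -/
def BrauerEquiv (A B : AzumayaAlgebra R) : Prop :=
  ∃ V W : Progenerator R,
    Nonempty (A.carrier ⊗[R] Module.End R V.carrier ≃ₐ[R]
      B.carrier ⊗[R] Module.End R W.carrier)

theorem BrauerEquiv.refl (A : AzumayaAlgebra R) : BrauerEquiv A A :=
  ⟨.unit, .unit, ⟨AlgEquiv.refl⟩⟩

theorem BrauerEquiv.of_algEquiv {A B : AzumayaAlgebra R} (e : A.carrier ≃ₐ[R] B.carrier) :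
    BrauerEquiv A B :=
  ⟨.unit, .unit, ⟨Algebra.TensorProduct.congr e AlgEquiv.refl⟩⟩

theorem BrauerEquiv.symm {A B : AzumayaAlgebra R} : BrauerEquiv A B → BrauerEquiv B A := by
  rintro ⟨V, W, ⟨e⟩⟩
  exact ⟨W, V, ⟨e.symm⟩⟩

/-- `A ⊗ End (V ⊗ W) ≅ (A ⊗ End V) ⊗ End W`. -/
def tensorEndTensor (A : AzumayaAlgebra R) (V W : Progenerator R) :
    A.carrier ⊗[R] Module.End R (V.tensor W).carrier ≃ₐ[R]
      (A.carrier ⊗[R] Module.End R V.carrier) ⊗[R] Module.End R W.carrier :=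
  (Algebra.TensorProduct.congr AlgEquiv.refl
    (endTensorEquiv R V.carrier W.carrier).symm).trans
    (Algebra.TensorProduct.assoc R R R A.carrier (Module.End R V.carrier)
      (Module.End R W.carrier)).symm

theorem BrauerEquiv.trans {A B C : AzumayaAlgebra R} :
    BrauerEquiv A B → BrauerEquiv B C → BrauerEquiv A C := by
  rintro ⟨V, W, ⟨e⟩⟩ ⟨V', W', ⟨e'⟩⟩
  refine ⟨V.tensor V', W'.tensor W, ⟨?_⟩⟩
  refine (tensorEndTensor A V V').trans ?_
  refine (Algebra.TensorProduct.congr e AlgEquiv.refl).trans ?_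
  refine (Algebra.TensorProduct.assoc R R R _ _ _).trans ?_
  refine (Algebra.TensorProduct.congr AlgEquiv.refl (Algebra.TensorProduct.comm R _ _)).trans ?_
  refine (Algebra.TensorProduct.assoc R R R _ _ _).symm.trans ?_
  refine (Algebra.TensorProduct.congr e' AlgEquiv.refl).trans ?_
  exact (tensorEndTensor C W' W).symm

/-- The tensor product of Azumaya algebras. -/
def AzumayaAlgebra.tensor (A B : AzumayaAlgebra R) : AzumayaAlgebra R :=
  have := isAzumaya_tensor R A.carrier B.carrier
  ⟨A.carrier ⊗[R] B.carrier⟩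

/-- The opposite of an Azumaya algebra. -/
def AzumayaAlgebra.op (A : AzumayaAlgebra R) : AzumayaAlgebra R :=
  have := isAzumaya_op R A.carrier
  ⟨A.carrierᵐᵒᵖ⟩

theorem BrauerEquiv.tensor {A A' B B' : AzumayaAlgebra R} :
    BrauerEquiv A A' → BrauerEquiv B B' → BrauerEquiv (A.tensor B) (A'.tensor B') := by
  have key : ∀ (A B : AzumayaAlgebra R) (V W : Progenerator R),
      Nonempty ((A.carrier ⊗[R] B.carrier) ⊗[R] Module.End R (V.tensor W).carrier ≃ₐ[R]
        (A.carrier ⊗[R] Module.End R V.carrier) ⊗[R] (B.carrier ⊗[R] Module.End R W.carrier)) :=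
    fun A B V W => ⟨(Algebra.TensorProduct.congr AlgEquiv.refl
      (endTensorEquiv R V.carrier W.carrier).symm).trans
      (Algebra.TensorProduct.tensorTensorTensorComm R R R R _ _ _ _)⟩
  rintro ⟨V, W, ⟨e⟩⟩ ⟨V', W', ⟨e'⟩⟩
  obtain ⟨f⟩ := key A B V V'
  obtain ⟨g⟩ := key A' B' W W'
  exact ⟨V.tensor V', W.tensor W', ⟨(f.trans (Algebra.TensorProduct.congr e e')).trans g.symm⟩⟩

variable (R) in
/-- Brauer equivalence as a setoid. -/
def brauerSetoid : Setoid (AzumayaAlgebra R) :=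
  ⟨BrauerEquiv, BrauerEquiv.refl, BrauerEquiv.symm, BrauerEquiv.trans⟩

variable (R) in
/-- The Brauer group `Br(Spec R)`: Azumaya algebras over `R` modulo Brauer equivalence. -/
def Br : Type (u + 1) := Quotient (brauerSetoid R)

/-- The class of a bundled Azumaya algebra. -/
def Br.mk (A : AzumayaAlgebra R) : Br R := Quotient.mk (brauerSetoid R) A

variable (R) in
/-- The Brauer class `[A]` of an Azumaya algebra `A`. -/
def brauerClass (A : Type u) [Ring A] [Algebra R A] [IsAzumaya R A] : Br R :=
  Br.mk ⟨A⟩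

/-- Multiplication in the Brauer group is `[A] * [B] = [A ⊗ B]`, and the unit is `[R]`. -/
instance : CommMonoid (Br R) where
  mul := Quotient.map₂ AzumayaAlgebra.tensor fun _ _ h _ _ h' => BrauerEquiv.tensor h h'
  one := brauerClass R R
  mul_assoc := by
    rintro ⟨A⟩ ⟨B⟩ ⟨C⟩
    exact Quotient.sound (s := brauerSetoid R)
      (BrauerEquiv.of_algEquiv (Algebra.TensorProduct.assoc R R R _ _ _))
  one_mul := by
    rintro ⟨A⟩
    exact Quotient.sound (s := brauerSetoid R)
      (BrauerEquiv.of_algEquiv (Algebra.TensorProduct.lid R _))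
  mul_one := by
    rintro ⟨A⟩
    exact Quotient.sound (s := brauerSetoid R)
      (BrauerEquiv.of_algEquiv (Algebra.TensorProduct.rid R R _))
  mul_comm := by
    rintro ⟨A⟩ ⟨B⟩
    exact Quotient.sound (s := brauerSetoid R)
      (BrauerEquiv.of_algEquiv (Algebra.TensorProduct.comm R _ _))

theorem Br.mk_mul_mk_op (A : AzumayaAlgebra R) :
    Br.mk A * Br.mk A.op = 1 := by
  have e₀ : Module.End R R ≃ₐ[R] R :=
    (AlgEquiv.moduleEndSelf R (A := R)).symm.trans (AlgEquiv.toOpposite R R).symm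
  have e : (A.carrier ⊗[R] A.carrierᵐᵒᵖ) ⊗[R] Module.End R R ≃ₐ[R]
      R ⊗[R] Module.End R A.carrier :=
    ((Algebra.TensorProduct.congr
      (AlgEquiv.ofBijective (AlgHom.mulLeftRight R A.carrier) IsAzumaya.bij) e₀).trans
      (Algebra.TensorProduct.rid R R _)).trans (Algebra.TensorProduct.lid R _).symm
  exact Quotient.sound (s := brauerSetoid R) ⟨.unit, A.toProgenerator, ⟨e⟩⟩

/-- The inverse in the Brauer group is `[A]⁻¹ = [Aᵒᵖ]`. -/
instance : CommGroup (Br R) where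
  inv := Quotient.map AzumayaAlgebra.op fun A B h => by
    have hAB : Br.mk A = Br.mk B :=
      Quotient.sound h
    have hA := Br.mk_mul_mk_op A
    have hB := Br.mk_mul_mk_op B
    rw [← hAB, mul_comm] at hB
    exact Quotient.exact (s := brauerSetoid R) (left_inv_eq_right_inv hB hA).symm
  inv_mul_cancel := by
    rintro ⟨A⟩
    exact (mul_comm _ _).trans (Br.mk_mul_mk_op A)

end Brauer

/-! ### Pushforward of algebras along automorphisms of the base -/

section Pushforward

/-- For an automorphism `φ` of `Spec R` with dual ring automorphism `f : R → R`, the pushforward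
`φ_* A`: the ring `A` with the new structure map `R → R → A`. -/
def Pushforward {R : Type u} [CommRing R] (_f : R ≃+* R) (A : Type u) : Type u := A

variable {R : Type u} [CommRing R] (f : R ≃+* R) (A : Type u) [Ring A] [Algebra R A]

instance : Ring (Pushforward f A) := inferInstanceAs (Ring A)

instance : Algebra R (Pushforward f A) :=
  ((algebraMap R A).comp (f : R →+* R)).toAlgebra' fun r a => Algebra.commutes (f r) (a : A)

theorem Pushforward.algebraMap_eq :
    algebraMap R (Pushforward f A) = (algebraMap R A).comp (f : R →+* R) := rfl

theorem Pushforward.smul_eq (r : R) (a : A) :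
    (r • (show Pushforward f A from a)) = (show Pushforward f A from (f r • a)) := by
  rw [Algebra.smul_def, Algebra.smul_def]
  rfl

/-- The pushforward of an Azumaya algebra is Azumaya. -/
instance Pushforward.isAzumaya [IsAzumaya R A] : IsAzumaya R (Pushforward f A) := by
  let g : R →+* R := f
  let g' : R →+* R := f.symm
  have i₁ : RingHomInvPair g g' := RingHomInvPair.of_ringEquiv f
  have i₂ : RingHomInvPair g' g := RingHomInvPair.of_ringEquiv f.symm
  let e : A ≃ₛₗ[g'] Pushforward f A :=
    { toFun := fun a => a
      invFun := fun a => a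
      left_inv := fun _ => rfl
      right_inv := fun _ => rfl
      map_add' := fun _ _ => rfl
      map_smul' := fun r a => by
        refine Eq.trans ?_ (Pushforward.smul_eq f A (f.symm r) a).symm
        rw [RingEquiv.apply_symm_apply] }
  have : Module.Projective R (Pushforward f A) := .of_equiv e
  have : Module.Finite R (Pushforward f A) := .of_surjective e.toLinearMap e.surjective
  have : FaithfulSMul R (Pushforward f A) := by
    refine ⟨fun {r s} h => f.injective (FaithfulSMul.eq_of_smul_eq_smul (α := A) fun a => ?_)⟩
    exact (Pushforward.smul_eq f A r a).symm.trans ((h a).trans (Pushforward.smul_eq f A s a))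
  let eop : Aᵐᵒᵖ ≃ₛₗ[g'] (Pushforward f A)ᵐᵒᵖ :=
    { toFun := fun a => .op (e a.unop)
      invFun := fun a => .op (e.symm a.unop)
      left_inv := fun _ => rfl
      right_inv := fun _ => rfl
      map_add' := fun _ _ => rfl
      map_smul' := fun r a => congrArg MulOpposite.op (e.map_smulₛₗ r a.unop) }
  let t : A ⊗[R] Aᵐᵒᵖ ≃ₛₗ[g'] Pushforward f A ⊗[R] (Pushforward f A)ᵐᵒᵖ :=
    TensorProduct.congr e eop
  let c : Module.End R A ≃ Module.End R (Pushforward f A) :=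
    { toFun := fun u => (e.toLinearMap.comp u).comp e.symm.toLinearMap
      invFun := fun u => (e.symm.toLinearMap.comp u).comp e.toLinearMap
      left_inv := fun u => by ext; simp
      right_inv := fun u => by ext; simp }
  have key : ∀ x, AlgHom.mulLeftRight R (Pushforward f A) (t x)
      = c (AlgHom.mulLeftRight R A x) := by
    intro x
    induction x with
    | zero => rw [map_zero, map_zero, map_zero]; ext; simp [c]
    | add x y hx hy => rw [map_add, map_add, map_add, hx, hy]; ext; simp [c]
    | tmul a b =>
      ext z
      simp only [t, TensorProduct.congr_tmul, AlgHom.mulLeftRight_apply]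
      change _ = e (AlgHom.mulLeftRight R A (a ⊗ₜ b) (e.symm z))
      rw [AlgHom.mulLeftRight_apply]
      rfl
  refine ⟨?_⟩
  have h : ⇑(AlgHom.mulLeftRight R (Pushforward f A))
      = c ∘ AlgHom.mulLeftRight R A ∘ t.symm := by
    funext x
    obtain ⟨x, rfl⟩ := t.surjective x
    simp [key]
  rw [h]
  exact c.bijective.comp (IsAzumaya.bij.comp t.symm.bijective)

end Pushforward

/-! ### The Weyl algebra -/

section Weyl

variable (n : ℕ) (k : Type u) [Field k]

/-- The indices of the `2n` generators: `inl i` stands for `i` and `inr i` for `n + i`. -/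
abbrev Ind : Type := Fin n ⊕ Fin n

/-- The constant `δ_{i,j+n} - δ_{i+n,j}`. -/
def weylForm : Ind n → Ind n → k
  | .inr i, .inl j => if i = j then 1 else 0
  | .inl i, .inr j => if i = j then -1 else 0
  | _, _ => 0

/-- The relations `[x_i, x_j] = δ_{i,j+n} - δ_{i+n,j}`. -/
inductive WeylRel : FreeAlgebra k (Ind n) → FreeAlgebra k (Ind n) → Prop
  | comm (i j : Ind n) :
    WeylRel (FreeAlgebra.ι k i * FreeAlgebra.ι k j - FreeAlgebra.ι k j * FreeAlgebra.ι k i)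
      (algebraMap k _ (weylForm n k i j))

/-- The Weyl algebra `A_n(k)`. -/
def WeylAlgebra : Type u := RingQuot (WeylRel n k)

instance : Ring (WeylAlgebra n k) := inferInstanceAs (Ring (RingQuot (WeylRel n k)))

instance : Algebra k (WeylAlgebra n k) := inferInstanceAs (Algebra k (RingQuot (WeylRel n k)))

/-- The generators `x_i` of the Weyl algebra. -/
def weylGen (i : Ind n) : WeylAlgebra n k := RingQuot.mkAlgHom k (WeylRel n k) (FreeAlgebra.ι k i)

theorem weylGen_comm (i j : Ind n) :
    weylGen n k i * weylGen n k j - weylGen n k j * weylGen n k i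
      = algebraMap k (WeylAlgebra n k) (weylForm n k i j) := by
  have h := RingQuot.mkAlgHom_rel k (WeylRel.comm (k := k) i j)
  rw [map_sub, map_mul, map_mul, AlgHom.commutes] at h
  exact h

theorem weylGen_induction {P : WeylAlgebra n k → Prop}
    (hk : ∀ c, P (algebraMap k _ c)) (hx : ∀ i, P (weylGen n k i))
    (hm : ∀ a b, P a → P b → P (a * b)) (ha : ∀ a b, P a → P b → P (a + b))
    (a : WeylAlgebra n k) : P a := by
  obtain ⟨a, rfl⟩ := RingQuot.mkAlgHom_surjective k (WeylRel n k) a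
  induction a using FreeAlgebra.induction with
  | grade0 c => rw [AlgHom.commutes]; exact hk c
  | grade1 i => exact hx i
  | mul a b h h' => rw [map_mul]; exact hm _ _ h h'
  | add a b h h' => rw [map_add]; exact ha _ _ h h'

/-- In characteristic `p` the elements `x_i ^ p` are central. -/
theorem weylGen_pow_central (p : ℕ) [CharP k p] (i : Ind n) (a : WeylAlgebra n k) :
    weylGen n k i ^ p * a = a * weylGen n k i ^ p := by
  have key : ∀ (j : Ind n) (m : ℕ), weylGen n k i ^ m * weylGen n k j
      = weylGen n k j * weylGen n k i ^ m
        + algebraMap k _ ((m : k) * weylForm n k i j) * weylGen n k i ^ (m - 1) := by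
    intro j m
    induction m with
    | zero => simp
    | succ m ih =>
      have h1 : weylGen n k i * weylGen n k j = weylGen n k j * weylGen n k i
          + algebraMap k _ (weylForm n k i j) := by
        rw [← weylGen_comm]; abel
      have h2 : (weylGen n k i) * (algebraMap k (WeylAlgebra n k) ((m : k) * weylForm n k i j)
          * weylGen n k i ^ (m - 1)) = algebraMap k _ ((m : k) * weylForm n k i j)
            * weylGen n k i ^ m := by
        rw [← mul_assoc, ← Algebra.commutes, mul_assoc]
        cases m with
        | zero => simp
        | succ m => rw [← pow_succ']; simp
      rw [pow_succ', mul_assoc, ih, mul_add, h2, ← mul_assoc, h1]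
      rw [Nat.add_sub_cancel, Nat.cast_succ, add_mul (m : k), map_add, one_mul]
      simp only [add_mul, mul_assoc]
      abel
  induction a using weylGen_induction with
  | hk c => exact (Algebra.commutes c _).symm
  | hx j => rw [key, CharP.cast_eq_zero, zero_mul, map_zero, zero_mul, add_zero]
  | hm a b h h' => rw [← mul_assoc, h, mul_assoc, h', mul_assoc]
  | ha a b h h' => rw [mul_add, h, h', add_mul]

/-- The coordinate ring `k[z_1, …, z_{2n}]` of `𝔸^{2n}_k`. -/
abbrev Coord : Type u := MvPolynomial (Ind n) k

/-- The map `k[z_1, …, z_{2n}] → Center(A_n(k))`, `z_i ↦ x_i ^ p`. -/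
def toCenter (p : ℕ) [CharP k p] : Coord n k →ₐ[k] Subalgebra.center k (WeylAlgebra n k) :=
  MvPolynomial.aeval fun i => ⟨weylGen n k i ^ p,
    Subalgebra.mem_center_iff.2 fun a => (weylGen_pow_central n k p i a).symm⟩

/-- The Weyl algebra `A_n(k)`, for `k` of characteristic `p`, as an algebra over
`k[z_1, …, z_{2n}]` via `z_i ↦ x_i ^ p`. -/
def Weyl (_p n : ℕ) (k : Type u) [Field k] : Type u := WeylAlgebra n k

instance (p : ℕ) : Ring (Weyl p n k) := inferInstanceAs (Ring (WeylAlgebra n k))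

instance (p : ℕ) [CharP k p] : Algebra (Coord n k) (Weyl p n k) :=
  ((Subalgebra.center k (WeylAlgebra n k)).val.comp (toCenter n k p)).toRingHom.toAlgebra'
    fun r a => (Subalgebra.mem_center_iff.1 (toCenter n k p r).2 a).symm

theorem algebraMap_X (p : ℕ) [CharP k p] (i : Ind n) :
    algebraMap (Coord n k) (Weyl p n k) (MvPolynomial.X i) = weylGen n k i ^ p := by
  change ((toCenter n k p (MvPolynomial.X i) : Subalgebra.center k (WeylAlgebra n k)) :
    WeylAlgebra n k) = _
  simp [toCenter]

variable {k}

/-- The exponent `ω_i`: `0` on the first `n` indices and `1` on the last `n`. -/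
def omegaExp : Ind n → ℕ
  | .inl _ => 0
  | .inr _ => 1

/-- The automorphism of `k[z_1, …, z_{2n}]` given by `z_i ↦ c ^ (-ω_i) z_i`; it is dual to the
automorphism `ω(c)` of `𝔸^{2n}_k`. -/
def omegaBar (c : kˣ) : Coord n k ≃ₐ[k] Coord n k :=
  AlgEquiv.ofAlgHom
    (MvPolynomial.aeval fun i => MvPolynomial.C ((c⁻¹ ^ omegaExp n i : kˣ) : k) * MvPolynomial.X i)
    (MvPolynomial.aeval fun i => MvPolynomial.C ((c ^ omegaExp n i : kˣ) : k) * MvPolynomial.X i)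
    (by
      ext i : 1
      simp only [AlgHom.comp_apply, MvPolynomial.aeval_X, map_mul, MvPolynomial.algHom_C,
        MvPolynomial.algebraMap_eq, AlgHom.id_apply]
      rw [← mul_assoc, ← MvPolynomial.C_mul, ← Units.val_mul, ← mul_pow]
      simp)
    (by
      ext i : 1
      simp only [AlgHom.comp_apply, MvPolynomial.aeval_X, map_mul, MvPolynomial.algHom_C,
        MvPolynomial.algebraMap_eq, AlgHom.id_apply]
      rw [← mul_assoc, ← MvPolynomial.C_mul, ← Units.val_mul, ← mul_pow]
      simp)

theorem omegaBar_X (c : kˣ) (i : Ind n) :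
    omegaBar n c (MvPolynomial.X i)
      = MvPolynomial.C ((c⁻¹ ^ omegaExp n i : kˣ) : k) * MvPolynomial.X i := by
  simp only [omegaBar, AlgEquiv.ofAlgHom_apply, MvPolynomial.aeval_X]

/-- `ω(c)_* A_n(k)`. -/
abbrev OmegaPush (p n : ℕ) (c : kˣ) : Type u :=
  Pushforward (omegaBar n c).toRingEquiv (Weyl p n k)

instance (p : ℕ) [Fact p.Prime] :
    IsAzumaya (Coord n k) (Matrix (Fin (p ^ n)) (Fin (p ^ n)) (Coord n k)) :=
  have : Nonempty (Fin (p ^ n)) := ⟨⟨0, Nat.pow_pos (Fact.out : p.Prime).pos⟩⟩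
  IsAzumaya.matrix _ _

open scoped Classical in
/-- The map `c ↦ [ω(c)_* A_n(k)]` from `k` to the Brauer group of `𝔸^{2n}_k`, where
`ω(0)_* A_n(k)` is read as the matrix algebra of size `p ^ n`. -/
def omegaClass (p n : ℕ) [Fact p.Prime] [CharP k p] [IsAzumaya (Coord n k) (Weyl p n k)] (c : k) :
    Br (Coord n k) :=
  if h : c = 0 then brauerClass (Coord n k) (Matrix (Fin (p ^ n)) (Fin (p ^ n)) (Coord n k))
  else brauerClass (Coord n k) (OmegaPush p n (Units.mk0 c h))

end Weyl

end WeylBrauer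

end

/-!
# The Brauer classes of twisted Weyl algebras

For a commutative ring `R` of characteristic `p` and `a, b : R`, let `[a, b)` be the class of the
symbol algebra with generators `x, y` and relations `y x - x y = 1`, `x ^ p = a`, `y ^ p = b`.
Over `R = k[z_1, …, z_{2n}]`, the algebra `ω(c)_* A_n(k)` is the tensor product over `i` of the
symbol algebras of `z_i, c z_{n+i}` (`nonempty_symbolAlgebra_algEquiv_omegaPush`,
`nonempty_symbolAlgebra_succ_algEquiv`), so its class is `∏ i, [z_i, c z_{n+i})`.

* Multiplication by `X` and `d/dX` generate the endomorphism algebra of `R[X] / (X ^ p - a)`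
  (`truncEnd_mem`). Hence the symbol of `a, 0` is this endomorphism algebra, and so `[a, 0) = 1`;
  by a change of variables, `[0, b) = 1`. As an `R`-module the symbol algebra of `a, b` is
  `R[X] / (X ^ p - a) ⊗ R[Y] / (Y ^ p - b)` by normal ordering, and the multiplications and
  commutators by `x` and `y` act as `X`, `d/dX`, `Y`, `d/dY`. So the symbol algebra is Azumaya
  (`isAzumaya_symbol`), and so is `A_n(k)`. An Azumaya algebra that is free as a module has center
  `R`.
* If `x₁, y₁` and `x₂, y₂` generate the symbols of `a, b` and of `a, b'`, then the pairs
  `x₁, y₁ + y₂` and `x₂ - x₁, y₂` commute with each other and generate the symbols of `a, b + b'`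
  and of `0, b'`. Hence `[a, b) [a, b') = [a, b + b')` (`symbolClass_add`). This gives the
  additivity of `c ↦ [ω(c)_* A_n(k)]`, and thereby `[A_n(k)] ^ p = [ω(p)_* A_n(k)] = 1`.
* `A_n(k)` has no zero divisors (`weyl_noZeroDivisors`): it acts faithfully on the polynomials in
  `2n` variables, as on itself by left multiplication written in normally ordered form, and there
  the leading form of a product is the product of the leading forms. An Azumaya algebra over a
  domain that has no zero divisors and is not commutative is not split
  (`brauerClass_ne_one_of_noZeroDivisors`). As `p` is prime, `[A_n(k)]` has order exactly `p`.
-/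

namespace WeylBrauer

/-! ### Symbol algebras -/

section Symbol

variable {R : Type u} [CommRing R] {ι : Type} [DecidableEq ι]

/-- Families `x, y` in an `R`-algebra with the relations of the symbol algebra of `a, b`: the `x i`
commute, the `y i` commute, `[y i, x j] = δ_{ij}`, `x i ^ p = a i` and `y i ^ p = b i`. -/
structure IsSymbolSystem {A : Type*} [Ring A] [Algebra R A] (p : ℕ) (a b : ι → R)
    (x y : ι → A) : Prop where
  xx : ∀ i j, x i * x j = x j * x i
  yy : ∀ i j, y i * y j = y j * y i
  yx : ∀ i j, y i * x j = x j * y i + if i = j then 1 else 0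
  xp : ∀ i, x i ^ p = algebraMap R A (a i)
  yp : ∀ i, y i ^ p = algebraMap R A (b i)

/-- The defining relations of the symbol algebra; `inl i` indexes `x i` and `inr i` indexes
`y i`. -/
inductive SymbolRel (p : ℕ) (a b : ι → R) : FreeAlgebra R (ι ⊕ ι) → FreeAlgebra R (ι ⊕ ι) → Prop
  | xx (i j : ι) : SymbolRel p a b
      (FreeAlgebra.ι R (.inl i) * FreeAlgebra.ι R (.inl j))
      (FreeAlgebra.ι R (.inl j) * FreeAlgebra.ι R (.inl i))
  | yy (i j : ι) : SymbolRel p a b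
      (FreeAlgebra.ι R (.inr i) * FreeAlgebra.ι R (.inr j))
      (FreeAlgebra.ι R (.inr j) * FreeAlgebra.ι R (.inr i))
  | yx (i j : ι) : SymbolRel p a b
      (FreeAlgebra.ι R (.inr i) * FreeAlgebra.ι R (.inl j))
      (FreeAlgebra.ι R (.inl j) * FreeAlgebra.ι R (.inr i) + if i = j then 1 else 0)
  | xp (i : ι) : SymbolRel p a b (FreeAlgebra.ι R (.inl i) ^ p) (algebraMap R _ (a i))
  | yp (i : ι) : SymbolRel p a b (FreeAlgebra.ι R (.inr i) ^ p) (algebraMap R _ (b i))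

/-- The symbol algebra of two families `a, b` in `R`: the universal `R`-algebra with an
`IsSymbolSystem`. For a single pair it is the `p`-symbol with `[y, x] = 1`, `x ^ p = a`,
`y ^ p = b`. -/
def SymbolAlgebra (p : ℕ) (a b : ι → R) : Type u := RingQuot (SymbolRel p a b)

variable (p : ℕ) (a b : ι → R)

noncomputable instance : Ring (SymbolAlgebra p a b) :=
  inferInstanceAs (Ring (RingQuot (SymbolRel p a b)))

noncomputable instance : Algebra R (SymbolAlgebra p a b) :=
  inferInstanceAs (Algebra R (RingQuot (SymbolRel p a b)))

/-- The generators `x i` of the symbol algebra. -/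
noncomputable def symX (i : ι) : SymbolAlgebra p a b :=
  RingQuot.mkAlgHom R (SymbolRel p a b) (FreeAlgebra.ι R (.inl i))

/-- The generators `y i` of the symbol algebra. -/
noncomputable def symY (i : ι) : SymbolAlgebra p a b :=
  RingQuot.mkAlgHom R (SymbolRel p a b) (FreeAlgebra.ι R (.inr i))

theorem isSymbolSystem_sym : IsSymbolSystem p a b (symX p a b) (symY p a b) where
  xx i j := by
    have h := RingQuot.mkAlgHom_rel R (SymbolRel.xx (p := p) (a := a) (b := b) i j)
    rw [map_mul, map_mul] at h
    exact h
  yy i j := by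
    have h := RingQuot.mkAlgHom_rel R (SymbolRel.yy (p := p) (a := a) (b := b) i j)
    rw [map_mul, map_mul] at h
    exact h
  yx i j := by
    have h := RingQuot.mkAlgHom_rel R (SymbolRel.yx (p := p) (a := a) (b := b) i j)
    rw [map_mul, map_add, map_mul, apply_ite (RingQuot.mkAlgHom R _), map_one, map_zero] at h
    exact h
  xp i := by
    have h := RingQuot.mkAlgHom_rel R (SymbolRel.xp (p := p) (a := a) (b := b) i)
    rw [map_pow, AlgHom.commutes] at h
    exact h
  yp i := by
    have h := RingQuot.mkAlgHom_rel R (SymbolRel.yp (p := p) (a := a) (b := b) i)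
    rw [map_pow, AlgHom.commutes] at h
    exact h

variable {p a b} {A B : Type*} [Ring A] [Algebra R A] [Ring B] [Algebra R B]

theorem IsSymbolSystem.map {x y : ι → A} (h : IsSymbolSystem p a b x y) (f : A →ₐ[R] B) :
    IsSymbolSystem p a b (fun i => f (x i)) (fun i => f (y i)) where
  xx i j := by rw [← map_mul, h.xx, map_mul]
  yy i j := by rw [← map_mul, h.yy, map_mul]
  yx i j := by rw [← map_mul, h.yx, map_add, map_mul, apply_ite f, map_one, map_zero]
  xp i := by rw [← map_pow, h.xp, AlgHom.commutes]
  yp i := by rw [← map_pow, h.yp, AlgHom.commutes]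

/-- The homomorphism from the symbol algebra determined by an `IsSymbolSystem`. -/
noncomputable def IsSymbolSystem.lift {x y : ι → A} (h : IsSymbolSystem p a b x y) :
    SymbolAlgebra p a b →ₐ[R] A :=
  RingQuot.liftAlgHom R ⟨FreeAlgebra.lift R (Sum.elim x y), by
    intro u v huv
    cases huv with
    | xx i j => simpa using h.xx i j
    | yy i j => simpa using h.yy i j
    | yx i j =>
      rw [map_mul, map_add, map_mul, apply_ite (FreeAlgebra.lift R _), map_one, map_zero]
      simpa using h.yx i j
    | xp i => simpa using h.xp i
    | yp i => simpa using h.yp i⟩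

@[simp]
theorem IsSymbolSystem.lift_symX {x y : ι → A} (h : IsSymbolSystem p a b x y) (i : ι) :
    h.lift (symX p a b i) = x i := by
  refine (RingQuot.liftAlgHom_mkAlgHom_apply R _ _ _).trans ?_
  simp

@[simp]
theorem IsSymbolSystem.lift_symY {x y : ι → A} (h : IsSymbolSystem p a b x y) (i : ι) :
    h.lift (symY p a b i) = y i := by
  refine (RingQuot.liftAlgHom_mkAlgHom_apply R _ _ _).trans ?_
  simp

theorem SymbolAlgebra.hom_ext {f g : SymbolAlgebra p a b →ₐ[R] A}
    (hx : ∀ i, f (symX p a b i) = g (symX p a b i))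
    (hy : ∀ i, f (symY p a b i) = g (symY p a b i)) : f = g := by
  refine RingQuot.ringQuot_ext' _ _ _ (FreeAlgebra.hom_ext (funext fun i => ?_))
  cases i with
  | inl i => exact hx i
  | inr i => exact hy i

variable (p) in
/-- The symbol algebra of a single pair `a, b`: generators `x, y` with `[y, x] = 1`, `x ^ p = a`,
`y ^ p = b`. -/
abbrev Symbol (a b : R) : Type u := SymbolAlgebra p (fun _ : Unit => a) (fun _ : Unit => b)

theorem isSymbolSystem_unit {a b : R} {x y : A} (h : y * x = x * y + 1)
    (hx : x ^ p = algebraMap R A a) (hy : y ^ p = algebraMap R A b) :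
    IsSymbolSystem p (fun _ : Unit => a) (fun _ => b) (fun _ => x) (fun _ => y) where
  xx _ _ := rfl
  yy _ _ := rfl
  yx _ _ := by simpa using h
  xp _ := hx
  yp _ := hy

theorem Symbol.yx (a b : R) :
    symY p (fun _ => a) (fun _ => b) () * symX p (fun _ => a) (fun _ => b) ()
      = symX p (fun _ => a) (fun _ => b) () * symY p (fun _ => a) (fun _ => b) () + 1 := by
  simpa using (isSymbolSystem_sym p (fun _ : Unit => a) (fun _ => b)).yx () ()

theorem SymbolAlgebra.induction {P : SymbolAlgebra p a b → Prop} (h1 : P 1)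
    (hx : ∀ i s, P s → P (symX p a b i * s)) (hy : ∀ i s, P s → P (symY p a b i * s))
    (hadd : ∀ s t, P s → P t → P (s + t)) (hsmul : ∀ (r : R) s, P s → P (r • s))
    (s : SymbolAlgebra p a b) : P s := by
  let q : FreeAlgebra R (ι ⊕ ι) →ₐ[R] SymbolAlgebra p a b :=
    RingQuot.mkAlgHom R (SymbolRel p a b)
  have key : ∀ u : FreeAlgebra R (ι ⊕ ι), ∀ s, P s → P (q u * s) := by
    intro u
    induction u using FreeAlgebra.induction with
    | grade0 r =>
      intro s hs
      rw [AlgHom.commutes]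
      exact (Algebra.smul_def r s) ▸ hsmul r s hs
    | grade1 i =>
      cases i with
      | inl i => exact hx i
      | inr i => exact hy i
    | mul u v hu hv => intro s hs; rw [map_mul, mul_assoc]; exact hu _ (hv _ hs)
    | add u v hu hv => intro s hs; rw [map_add, add_mul]; exact hadd _ _ (hu _ hs) (hv _ hs)
  obtain ⟨u, rfl⟩ := RingQuot.mkAlgHom_surjective R (SymbolRel p a b) s
  exact mul_one (q u) ▸ key u 1 h1

theorem IsSymbolSystem.commute_lift {x y : ι → A} (h : IsSymbolSystem p a b x y) {z : A}
    (hx : ∀ i, Commute (x i) z) (hy : ∀ i, Commute (y i) z) (s : SymbolAlgebra p a b) :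
    Commute (h.lift s) z := by
  induction s using SymbolAlgebra.induction with
  | h1 => rw [map_one]; exact Commute.one_left z
  | hx i s hs => rw [map_mul, h.lift_symX]; exact (hx i).mul_left hs
  | hy i s hs => rw [map_mul, h.lift_symY]; exact (hy i).mul_left hs
  | hadd s t hs ht => rw [map_add]; exact hs.add_left ht
  | hsmul r s hs => rw [map_smul]; exact hs.smul_left r

/-- The homomorphism from a tensor product of symbol algebras determined by two mutually commuting
systems. -/
noncomputable def IsSymbolSystem.tensorLift {κ : Type} [DecidableEq κ] {a' b' : κ → R}
    {x y : ι → A} {x' y' : κ → A} (h : IsSymbolSystem p a b x y)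
    (h' : IsSymbolSystem p a' b' x' y') (hxx : ∀ i j, Commute (x i) (x' j))
    (hxy : ∀ i j, Commute (x i) (y' j)) (hyx : ∀ i j, Commute (y i) (x' j))
    (hyy : ∀ i j, Commute (y i) (y' j)) :
    SymbolAlgebra p a b ⊗[R] SymbolAlgebra p a' b' →ₐ[R] A :=
  Algebra.TensorProduct.lift h.lift h'.lift fun s t =>
    h.commute_lift (fun i => (h'.commute_lift (fun j => (hxx i j).symm)
      (fun j => (hxy i j).symm) t).symm)
      (fun i => (h'.commute_lift (fun j => (hyx i j).symm) (fun j => (hyy i j).symm) t).symm) s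

theorem symbolTensor_hom_ext {κ : Type} [DecidableEq κ] {a' b' : κ → R}
    {f g : SymbolAlgebra p a b ⊗[R] SymbolAlgebra p a' b' →ₐ[R] A}
    (hx : ∀ i, f (symX p a b i ⊗ₜ 1) = g (symX p a b i ⊗ₜ 1))
    (hy : ∀ i, f (symY p a b i ⊗ₜ 1) = g (symY p a b i ⊗ₜ 1))
    (hx' : ∀ i, f (1 ⊗ₜ symX p a' b' i) = g (1 ⊗ₜ symX p a' b' i))
    (hy' : ∀ i, f (1 ⊗ₜ symY p a' b' i) = g (1 ⊗ₜ symY p a' b' i)) : f = g :=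
  Algebra.TensorProduct.ext (SymbolAlgebra.hom_ext hx hy) (SymbolAlgebra.hom_ext hx' hy')

end Symbol

/-! ### Truncated polynomials and their differential operators -/

section Trunc

open Polynomial

variable {R : Type u} [CommRing R]

/-- A subalgebra of `End N` containing the matrix units of a basis of `N` is everything. -/
theorem mem_of_matrixUnits {N ι : Type*} [AddCommGroup N] [Module R N] [Fintype ι]
    [DecidableEq ι] (e : Module.Basis ι R N) (T : Subalgebra R (Module.End R N))
    (E : ι → ι → Module.End R N) (hE : ∀ i j, E i j ∈ T)
    (he : ∀ i j k, E i j (e k) = if j = k then e i else 0) (f : Module.End R N) : f ∈ T := by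
  have hf : f = ∑ i, ∑ j, e.repr (f (e j)) i • E i j := by
    refine e.ext fun k => ?_
    simp [LinearMap.sum_apply, he, e.sum_repr]
  rw [hf]
  exact Subalgebra.sum_mem _ fun i _ => Subalgebra.sum_mem _ fun j _ =>
    Subalgebra.smul_mem _ (hE i j) _

theorem cast_factorial_pred (p : ℕ) [Fact p.Prime] [CharP R p] :
    (((p - 1).factorial : ℕ) : R) = -1 := by
  have h := congrArg (ZMod.castHom (dvd_refl p) R) (ZMod.wilsons_lemma p)
  rwa [map_natCast, map_neg, map_one] at h

variable (p : ℕ) (a : R)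

/-- The module `R[X] / (X ^ p - a)`. -/
abbrev TruncPoly : Type u := AdjoinRoot (X ^ p - C a : R[X])

theorem monic_trunc [Fact p.Prime] : (X ^ p - C a : R[X]).Monic :=
  monic_X_pow_sub_C a (Fact.out : p.Prime).ne_zero

/-- Multiplication by `X` on `R[X] / (X ^ p - a)`. -/
noncomputable def truncMul : Module.End R (TruncPoly p a) :=
  LinearMap.mulLeft R (AdjoinRoot.root _)

theorem truncMul_mk (f : R[X]) :
    truncMul p a (AdjoinRoot.mk _ f) = AdjoinRoot.mk _ (X * f) := by
  rw [map_mul, AdjoinRoot.mk_X]; rfl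

theorem truncMul_pow_mk (m : ℕ) (f : R[X]) :
    (truncMul p a ^ m) (AdjoinRoot.mk _ f) = AdjoinRoot.mk _ (X ^ m * f) := by
  induction m generalizing f with
  | zero => simp
  | succ m ih => rw [pow_succ, Module.End.mul_apply, truncMul_mk, ih, pow_succ, mul_assoc]

theorem truncPoly_hom_ext {N : Type*} [AddCommGroup N] [Module R N] {f g : TruncPoly p a →ₗ[R] N}
    (h : ∀ m : ℕ, f (AdjoinRoot.mk _ (X ^ m)) = g (AdjoinRoot.mk _ (X ^ m))) : f = g := by
  refine LinearMap.ext fun t => ?_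
  obtain ⟨t, rfl⟩ := AdjoinRoot.mk_surjective t
  have : f ∘ₗ (AdjoinRoot.mkₐ (R := R) (X ^ p - C a : R[X])).toLinearMap
      = g ∘ₗ (AdjoinRoot.mkₐ (R := R) (X ^ p - C a : R[X])).toLinearMap := by
    refine Polynomial.lhom_ext' fun m => LinearMap.ext_ring ?_
    simpa [← X_pow_eq_monomial] using h m
  exact LinearMap.congr_fun this t

instance [Fact p.Prime] : Module.Free R (TruncPoly p a) := (monic_trunc p a).free_adjoinRoot
instance [Fact p.Prime] : Module.Finite R (TruncPoly p a) := (monic_trunc p a).finite_adjoinRoot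

theorem finrank_truncPoly [Fact p.Prime] [Nontrivial R] : Module.finrank R (TruncPoly p a) = p := by
  have h := (AdjoinRoot.powerBasis' (monic_trunc p a)).finrank
  rw [h, AdjoinRoot.powerBasis'_dim, natDegree_X_pow_sub_C]

theorem truncMul_pow : truncMul p a ^ p = algebraMap R _ a := by
  refine truncPoly_hom_ext p a fun m => ?_
  rw [truncMul_pow_mk, map_mul, Module.algebraMap_end_apply, Algebra.smul_def]
  congr 1
  rw [map_pow, AdjoinRoot.mk_X, ← sub_eq_zero]
  have h := AdjoinRoot.eval₂_root (X ^ p - C a : R[X])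
  rwa [eval₂_sub, eval₂_pow, eval₂_X, eval₂_C] at h

variable [CharP R p]

/-- The derivation `d/dX` of `R[X] / (X ^ p - a)`; it is well defined because
`d(X ^ p - a) / dX = 0` in characteristic `p`. -/
noncomputable def truncDeriv : Module.End R (TruncPoly p a) :=
  Submodule.mapQ ((Ideal.span {(X ^ p - C a : R[X])}).restrictScalars R)
    ((Ideal.span {(X ^ p - C a : R[X])}).restrictScalars R) derivative (by
      intro f hf
      obtain ⟨g, rfl⟩ := Ideal.mem_span_singleton'.1 hf
      refine Ideal.mem_span_singleton'.2 ⟨derivative g, ?_⟩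
      simp [derivative_mul, derivative_X_pow])

theorem truncDeriv_mk (f : R[X]) :
    truncDeriv p a (AdjoinRoot.mk _ f) = AdjoinRoot.mk _ (derivative f) := rfl

theorem truncDeriv_one : truncDeriv p a 1 = 0 := by
  rw [← map_one (AdjoinRoot.mk _), truncDeriv_mk]; simp

theorem truncDeriv_pow_mk (m : ℕ) (f : R[X]) :
    (truncDeriv p a ^ m) (AdjoinRoot.mk _ f) = AdjoinRoot.mk _ (derivative^[m] f) := by
  induction m generalizing f with
  | zero => simp
  | succ m ih => rw [pow_succ, Module.End.mul_apply, truncDeriv_mk, ih]; simp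

theorem truncDeriv_mul_truncMul :
    truncDeriv p a * truncMul p a = truncMul p a * truncDeriv p a + 1 := by
  refine LinearMap.ext fun t => ?_
  obtain ⟨f, rfl⟩ := AdjoinRoot.mk_surjective t
  simp only [Module.End.mul_apply, LinearMap.add_apply, truncMul_mk, truncDeriv_mk, ← map_add,
    Module.End.one_apply]
  congr 1
  simp [derivative_mul, add_comm]

variable [Fact p.Prime]

theorem truncDeriv_pow : truncDeriv p a ^ p = 0 := by
  refine truncPoly_hom_ext p a fun m => ?_
  rw [truncDeriv_pow_mk, iterate_derivative_X_pow_eq_natCast_mul,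
    Nat.descFactorial_eq_factorial_mul_choose, Nat.cast_mul,
    (CharP.cast_eq_zero_iff R[X] p _).2 (Nat.dvd_factorial (Fact.out : p.Prime).pos le_rfl)]
  simp

/-- Multiplication by `X` and `d/dX` generate `End (R[X] / (X ^ p - a))`: the operators
`- X ^ i (d/dX) ^ (p - 1) X ^ (p - 1 - j)` are the matrix units of the basis of powers of `X`. -/
theorem truncEnd_mem [Nontrivial R] (T : Subalgebra R (Module.End R (TruncPoly p a)))
    (hX : truncMul p a ∈ T) (hD : truncDeriv p a ∈ T) (f : Module.End R (TruncPoly p a)) :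
    f ∈ T := by
  have hdeg : (X ^ p - C a : R[X]).natDegree = p := natDegree_X_pow_sub_C
  have hp := (Fact.out : p.Prime).pos
  let e := AdjoinRoot.powerBasisAux' (monic_trunc p a)
  have he : ∀ i, e i = AdjoinRoot.mk _ (X ^ (i : ℕ)) := by
    intro i
    have := (AdjoinRoot.powerBasis' (monic_trunc p a)).basis_eq_pow i
    rw [map_pow, AdjoinRoot.mk_X]
    exact this
  refine mem_of_matrixUnits e T
    (fun i j => -(truncMul p a ^ (i : ℕ) * truncDeriv p a ^ (p - 1) * truncMul p a ^ (p - 1 - j)))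
    (fun i j => neg_mem (mul_mem (mul_mem (pow_mem hX _) (pow_mem hD _)) (pow_mem hX _))) ?_ f
  intro i j k
  have hj : (j : ℕ) < p := j.2.trans_eq hdeg
  have hk : (k : ℕ) < p := k.2.trans_eq hdeg
  rw [LinearMap.neg_apply, Module.End.mul_apply, Module.End.mul_apply, he, truncMul_pow_mk, he,
    ← pow_add]
  rcases lt_trichotomy j k with h | rfl | h
  · have h' : (j : ℕ) < k := h
    rw [if_neg h.ne, show p - 1 - (j : ℕ) + k = p + (k - j - 1) by omega, pow_add,
      ← truncMul_pow_mk, truncMul_pow, Module.algebraMap_end_apply, map_smul, truncDeriv_pow_mk,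
      iterate_derivative_X_pow_eq_natCast_mul, Nat.descFactorial_of_lt (by omega)]
    simp
  · rw [if_pos rfl, show p - 1 - (j : ℕ) + j = p - 1 by omega, truncDeriv_pow_mk,
      iterate_derivative_X_pow_eq_natCast_mul, Nat.descFactorial_self,
      cast_factorial_pred p, truncMul_pow_mk]
    simp
  · have h' : (k : ℕ) < j := h
    rw [if_neg h.ne', truncDeriv_pow_mk,
      iterate_derivative_X_pow_eq_natCast_mul, Nat.descFactorial_of_lt (by omega)]
    simp

end Trunc
/-! ### The symbol algebra of one pair -/

section OnePair

open Polynomial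

variable {R : Type u} [CommRing R] {p : ℕ} {A : Type*} [Ring A] [Algebra R A]

theorem add_pow_of_commute_of_charP (R : Type*) [CommRing R] [Fact p.Prime] [CharP R p]
    [Algebra R A] {x y : A} (h : Commute x y) : (x + y) ^ p = x ^ p + y ^ p := by
  have hp : (p : A) = 0 := by
    rw [← map_natCast (algebraMap R A), CharP.cast_eq_zero, map_zero]
  rw [h.add_pow_prime_eq Fact.out, hp, zero_mul, zero_mul, zero_mul, add_zero]

/-- Evaluation of truncated polynomials at an element `x` with `x ^ p = a`. -/
noncomputable def truncEval {a : R} {x : A} (hx : x ^ p = algebraMap R A a) :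
    TruncPoly p a →ₐ[R] A :=
  Ideal.Quotient.liftₐ (Ideal.span {(X ^ p - C a : R[X])}) (aeval x) (by
    intro f hf
    obtain ⟨g, rfl⟩ := Ideal.mem_span_singleton'.1 hf
    simp [hx])

theorem truncEval_mk {a : R} {x : A} (hx : x ^ p = algebraMap R A a) (f : R[X]) :
    truncEval hx (AdjoinRoot.mk _ f) = aeval x f := rfl

theorem truncEval_truncMul {a : R} {x : A} (hx : x ^ p = algebraMap R A a) (t : TruncPoly p a) :
    truncEval hx (truncMul p a t) = x * truncEval hx t := by
  obtain ⟨f, rfl⟩ := AdjoinRoot.mk_surjective t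
  rw [truncMul_mk, truncEval_mk, truncEval_mk, map_mul, aeval_X]

theorem commute_truncEval {a : R} {x : A} (hx : x ^ p = algebraMap R A a) (t : TruncPoly p a) :
    Commute x (truncEval hx t) := by
  obtain ⟨f, rfl⟩ := AdjoinRoot.mk_surjective t
  rw [truncEval_mk]
  conv_lhs => rw [← aeval_X (R := R) x]
  exact (Commute.all X f).map (aeval x)

/-- If `[y, x] = 1` then `[y, f(x)] = f'(x)`. -/
theorem mul_truncEval [CharP R p] {a : R} {x y : A} (hx : x ^ p = algebraMap R A a)
    (h : y * x = x * y + 1) (t : TruncPoly p a) :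
    y * truncEval hx t = truncEval hx t * y + truncEval hx (truncDeriv p a t) := by
  have key : (LinearMap.mulLeft R y) ∘ₗ (truncEval hx).toLinearMap
      = (LinearMap.mulRight R y) ∘ₗ (truncEval hx).toLinearMap
        + (truncEval hx).toLinearMap ∘ₗ truncDeriv p a := by
    refine truncPoly_hom_ext p a fun m => ?_
    simp only [LinearMap.comp_apply, LinearMap.add_apply, AlgHom.toLinearMap_apply,
      LinearMap.mulLeft_apply, LinearMap.mulRight_apply, truncDeriv_mk, truncEval_mk]
    simp only [derivative_X_pow, map_mul, map_pow, aeval_X, map_natCast]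
    induction m with
    | zero => simp
    | succ m ih =>
      rw [pow_succ, ← mul_assoc, ih, add_mul, mul_assoc, h, mul_add, mul_one, ← mul_assoc,
        Nat.add_sub_cancel, Nat.cast_succ, add_mul, one_mul, add_assoc, add_comm (_ ^ m)]
      congr 2
      cases m with
      | zero => simp
      | succ m => simp [pow_succ, mul_assoc]
  exact LinearMap.congr_fun key t

variable (p) [Fact p.Prime] [CharP R p] (a b : R)

/-- The generator `x` of the symbol algebra of one pair. -/
noncomputable abbrev genX : Symbol p a b := symX p (fun _ => a) (fun _ => b) ()

/-- The generator `y` of the symbol algebra of one pair. -/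
noncomputable abbrev genY : Symbol p a b := symY p (fun _ => a) (fun _ => b) ()

omit [Fact p.Prime] [CharP R p] in
theorem genX_pow : genX p a b ^ p = algebraMap R _ a :=
  (isSymbolSystem_sym p (fun _ : Unit => a) (fun _ => b)).xp ()

omit [Fact p.Prime] [CharP R p] in
theorem genY_pow : genY p a b ^ p = algebraMap R _ b :=
  (isSymbolSystem_sym p (fun _ : Unit => a) (fun _ => b)).yp ()

/-- The linear map `f ⊗ g ↦ f(x) g(y)` to the symbol algebra. -/
noncomputable def normalOrder : TruncPoly p a ⊗[R] TruncPoly p b →ₗ[R] Symbol p a b :=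
  LinearMap.mul' R _ ∘ₗ TensorProduct.map (truncEval (genX_pow p a b)).toLinearMap
    (truncEval (genY_pow p a b)).toLinearMap

omit [Fact p.Prime] [CharP R p] in
theorem normalOrder_tmul (f : TruncPoly p a) (g : TruncPoly p b) :
    normalOrder p a b (f ⊗ₜ g)
      = truncEval (genX_pow p a b) f * truncEval (genY_pow p a b) g := by
  simp [normalOrder]

/-- The operators `X ⊗ 1` and `d/dX ⊗ 1 + 1 ⊗ Y` satisfy the relations of the symbol algebra. -/
theorem isSymbolSystem_regular :
    IsSymbolSystem p (fun _ : Unit => a) (fun _ => b)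
      (fun _ => (truncMul p a).rTensor (TruncPoly p b))
      (fun _ => (truncDeriv p a).rTensor (TruncPoly p b)
        + (truncMul p b).lTensor (TruncPoly p a)) := by
  apply isSymbolSystem_unit
  · rw [add_mul, mul_add, ← LinearMap.rTensor_mul, truncDeriv_mul_truncMul,
      LinearMap.rTensor_add, LinearMap.rTensor_mul]
    have h1 : LinearMap.rTensor (TruncPoly p b) (1 : Module.End R (TruncPoly p a)) = 1 :=
      LinearMap.rTensor_id _ _
    have h2 : (truncMul p b).lTensor (TruncPoly p a) * (truncMul p a).rTensor (TruncPoly p b)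
        = (truncMul p a).rTensor (TruncPoly p b) * (truncMul p b).lTensor (TruncPoly p a) :=
      (LinearMap.lTensor_comp_rTensor _ _ _).trans (LinearMap.rTensor_comp_lTensor _ _ _).symm
    rw [h1, h2]
    abel
  · rw [LinearMap.rTensor_pow, truncMul_pow]
    exact TensorProduct.ext' fun u v => by simp [TensorProduct.smul_tmul']
  · rw [add_pow_of_commute_of_charP R, LinearMap.rTensor_pow, LinearMap.lTensor_pow,
      truncMul_pow, truncDeriv_pow, LinearMap.rTensor_zero, zero_add]
    · ext; simp
    · exact (LinearMap.rTensor_comp_lTensor _ _ _).trans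
        (LinearMap.lTensor_comp_rTensor _ _ _).symm

/-- The action of `f(x) g(y)` on `1 ⊗ 1` recovers `f ⊗ g`, so that `normalOrder` is injective. -/
theorem regular_normalOrder (t : TruncPoly p a ⊗[R] TruncPoly p b) :
    (isSymbolSystem_regular p a b).lift (normalOrder p a b t) (1 ⊗ₜ 1) = t := by
  have hy : ∀ m : ℕ, (((truncDeriv p a).rTensor (TruncPoly p b)
      + (truncMul p b).lTensor (TruncPoly p a)) ^ m) (1 ⊗ₜ 1)
        = 1 ⊗ₜ AdjoinRoot.mk _ (X ^ m) := by
    intro m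
    induction m with
    | zero => simp
    | succ m ih =>
      rw [pow_succ', Module.End.mul_apply, ih]
      simp only [LinearMap.add_apply, LinearMap.rTensor_tmul, LinearMap.lTensor_tmul,
        truncDeriv_one, TensorProduct.zero_tmul, zero_add, truncMul_mk]
      rw [pow_succ']
  have key : (LinearMap.applyₗ (1 ⊗ₜ 1)) ∘ₗ (isSymbolSystem_regular p a b).lift.toLinearMap
      ∘ₗ normalOrder p a b = LinearMap.id := by
    refine TensorProduct.ext ?_
    refine truncPoly_hom_ext p a fun m => truncPoly_hom_ext p b fun l => ?_
    simp only [LinearMap.compr₂ₛₗ_apply, TensorProduct.mk_apply, LinearMap.comp_apply,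
      normalOrder_tmul, truncEval_mk, AlgHom.toLinearMap_apply, LinearMap.applyₗ_apply_apply,
      LinearMap.id_apply]
    rw [map_pow, map_pow, aeval_X, aeval_X, map_mul, map_pow, map_pow, IsSymbolSystem.lift_symX,
      IsSymbolSystem.lift_symY, Module.End.mul_apply, hy, LinearMap.rTensor_pow, LinearMap.rTensor_tmul,
      ← map_one (AdjoinRoot.mk _), truncMul_pow_mk]
    simp
  exact LinearMap.congr_fun key t

omit [Fact p.Prime] in
theorem normalOrder_surjective : Function.Surjective (normalOrder p a b) := by
  intro s
  rw [← LinearMap.mem_range]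
  induction s using SymbolAlgebra.induction with
  | h1 => exact ⟨1 ⊗ₜ 1, by simp [normalOrder_tmul]⟩
  | hx i s hs =>
    obtain ⟨t, rfl⟩ := hs
    refine ⟨(truncMul p a).rTensor _ t, ?_⟩
    induction t with
    | zero => simp
    | add t t' h h' => simp only [map_add, mul_add, h, h']
    | tmul f g => rw [LinearMap.rTensor_tmul, normalOrder_tmul, normalOrder_tmul,
        truncEval_truncMul, mul_assoc]
  | hy i s hs =>
    obtain ⟨t, rfl⟩ := hs
    refine ⟨(truncDeriv p a).rTensor _ t + (truncMul p b).lTensor _ t, ?_⟩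
    induction t with
    | zero => simp
    | add t t' h h' =>
      rw [map_add (normalOrder p a b) t, mul_add, ← h, ← h']
      simp only [map_add]
      abel
    | tmul f g =>
      rw [LinearMap.rTensor_tmul, LinearMap.lTensor_tmul, map_add, normalOrder_tmul,
        normalOrder_tmul, normalOrder_tmul, truncEval_truncMul, ← mul_assoc, ← mul_assoc,
        mul_truncEval _ (Symbol.yx a b)]
      rw [add_mul, add_comm]
  | hadd s t hs ht => exact add_mem hs ht
  | hsmul r s hs => exact Submodule.smul_mem _ r hs

/-- The elements `x ^ i y ^ j` with `0 ≤ i, j < p` form a basis of the symbol algebra: the linear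
isomorphism `f ⊗ g ↦ f(x) g(y)`. -/
noncomputable def normalOrderEquiv : TruncPoly p a ⊗[R] TruncPoly p b ≃ₗ[R] Symbol p a b :=
  LinearEquiv.ofBijective (normalOrder p a b)
    ⟨Function.LeftInverse.injective
      (g := fun s => (isSymbolSystem_regular p a b).lift s (1 ⊗ₜ 1)) (regular_normalOrder p a b),
      normalOrder_surjective p a b⟩

instance : Module.Free R (Symbol p a b) := .of_equiv (normalOrderEquiv p a b)
instance : Module.Finite R (Symbol p a b) := .equiv (normalOrderEquiv p a b)

theorem finrank_symbol [Nontrivial R] : Module.finrank R (Symbol p a b) = p * p := by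
  rw [← (normalOrderEquiv p a b).finrank_eq, Module.finrank_tensorProduct, finrank_truncPoly,
    finrank_truncPoly]

omit p [Fact p.Prime] [CharP R p] a b in
theorem bijective_of_surjective_of_finrank_eq [Nontrivial R] {M N : Type*} [AddCommGroup M]
    [Module R M] [AddCommGroup N] [Module R N] [Module.Free R M] [Module.Finite R M]
    [Module.Free R N] [Module.Finite R N] (f : M →ₗ[R] N) (hf : Function.Surjective f)
    (h : Module.finrank R M = Module.finrank R N) : Function.Bijective f := by
  let e : N ≃ₗ[R] M := LinearEquiv.ofFinrankEq N M h.symm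
  refine ⟨?_, hf⟩
  have := OrzechProperty.injective_of_surjective_endomorphism (e.toLinearMap ∘ₗ f)
    (e.surjective.comp hf)
  exact Function.Injective.of_comp this

/-- The symbol algebra is Azumaya. Identify it with `R[X]/(X ^ p - a) ⊗ R[Y]/(Y ^ p - b)`. Left
multiplication by `x` and right multiplication by `y` become multiplication by `X` and `Y`, while
the commutators with `y` and `-x` become `d/dX` and `d/dY`; these generate all endomorphisms. -/
instance isAzumaya_symbol [Nontrivial R] : IsAzumaya R (Symbol p a b) := by
  let x := genX p a b
  let y := genY p a b
  let S := Symbol p a b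
  have hyx : y * x = x * y + 1 := Symbol.yx a b
  let θ := normalOrderEquiv p a b
  let T : Subalgebra R (Module.End R S) := (AlgHom.mulLeftRight R S).range
  let T₁ : Subalgebra R (Module.End R (TruncPoly p a ⊗[R] TruncPoly p b)) :=
    T.comap (θ.conjAlgEquiv R).toAlgHom
  have hL : ∀ s : S, LinearMap.mulLeft R s ∈ T := fun s => ⟨s ⊗ₜ 1, by ext; simp⟩
  have hR : ∀ s : S, LinearMap.mulRight R s ∈ T := fun s => ⟨1 ⊗ₜ .op s, by ext; simp⟩
  -- an operator of the tensor product lies in `T₁` as soon as `θ` intertwines it with one in `T`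
  have hT₁ : ∀ (g : Module.End R (TruncPoly p a ⊗[R] TruncPoly p b)) (g' : Module.End R S),
      g' ∈ T → (∀ u v, θ (g (u ⊗ₜ v)) = g' (θ (u ⊗ₜ v))) → g ∈ T₁ := by
    intro g g' hg' h
    have h1 : θ.toLinearMap ∘ₗ g = g' ∘ₗ θ.toLinearMap := TensorProduct.ext' h
    have h2 : (θ.conjAlgEquiv R).toAlgHom g = g' := by
      refine LinearMap.ext fun s => ?_
      obtain ⟨t, rfl⟩ := θ.surjective s
      simpa using LinearMap.congr_fun h1 t
    exact Subalgebra.mem_comap _ _ _ |>.2 (h2 ▸ hg')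
  -- pull back along `End ⊗ End ≅ End (· ⊗ ·)`, where the factors can be treated one by one
  let T₂ : Subalgebra R (Module.End R (TruncPoly p a) ⊗[R] Module.End R (TruncPoly p b)) :=
    T₁.comap (endTensorEquiv R (TruncPoly p a) (TruncPoly p b)).toAlgHom
  have happ : ∀ f g u v, endTensorEquiv R (TruncPoly p a) (TruncPoly p b) (f ⊗ₜ g) (u ⊗ₜ v)
      = f u ⊗ₜ g v := fun f g u v => rfl
  have hθ : ∀ u v, θ (u ⊗ₜ v) = truncEval (genX_pow p a b) u * truncEval (genY_pow p a b) v :=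
    normalOrder_tmul p a b
  have hleft : ∀ f, f ⊗ₜ[R] (1 : Module.End R (TruncPoly p b)) ∈ T₂ := by
    refine truncEnd_mem p a (T₂.comap Algebra.TensorProduct.includeLeft) ?_ ?_
    · refine hT₁ _ _ (hL x) fun u v => ?_
      refine (congrArg θ (happ _ _ u v)).trans ?_
      simp only [Module.End.one_apply, hθ, truncEval_truncMul, LinearMap.mulLeft_apply, mul_assoc]
      rfl
    · refine hT₁ _ _ (sub_mem (hL y) (hR y)) fun u v => ?_
      refine (congrArg θ (happ _ _ u v)).trans ?_
      simp only [Module.End.one_apply, hθ, LinearMap.sub_apply, LinearMap.mulLeft_apply,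
        LinearMap.mulRight_apply]
      rw [← mul_assoc, mul_truncEval (genX_pow p a b) hyx, add_mul, mul_assoc, mul_assoc,
        (commute_truncEval (genY_pow p a b) v).eq, add_sub_cancel_left]
  have hright : ∀ f, (1 : Module.End R (TruncPoly p a)) ⊗ₜ[R] f ∈ T₂ := by
    refine truncEnd_mem p b (T₂.comap Algebra.TensorProduct.includeRight) ?_ ?_
    · refine hT₁ _ _ (hR y) fun u v => ?_
      refine (congrArg θ (happ _ _ u v)).trans ?_
      simp only [Module.End.one_apply, hθ, truncEval_truncMul, LinearMap.mulRight_apply, mul_assoc]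
      rw [← (commute_truncEval (genY_pow p a b) v).eq]
    · refine hT₁ _ _ (sub_mem (hR x) (hL x)) fun u v => ?_
      refine (congrArg θ (happ _ _ u v)).trans ?_
      -- `y, -x` is again a pair with commutator `1`
      have hxy : -x * y = y * -x + 1 := by
        rw [mul_neg, hyx]; noncomm_ring
      have h := mul_truncEval (genY_pow p a b) hxy v
      have h' : truncEval (genY_pow p a b) (truncDeriv p b v)
          = truncEval (genY_pow p a b) v * x - x * truncEval (genY_pow p a b) v := by
        rw [neg_mul, mul_neg] at h
        rw [← sub_eq_iff_eq_add'.2 h]; abel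
      simp only [Module.End.one_apply, hθ, LinearMap.sub_apply, LinearMap.mulLeft_apply,
        LinearMap.mulRight_apply]
      rw [h', mul_sub, ← mul_assoc, ← mul_assoc, ← mul_assoc,
        (commute_truncEval (genX_pow p a b) u).eq]
  have hT₂ : ∀ z, z ∈ T₂ := by
    intro z
    induction z with
    | zero => exact zero_mem _
    | add z w hz hw => exact add_mem hz hw
    | tmul f g =>
      have := mul_mem (hleft f) (hright g)
      rwa [Algebra.TensorProduct.tmul_mul_tmul, mul_one, one_mul] at this
  have hsurj : Function.Surjective (AlgHom.mulLeftRight R S) := by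
    intro f
    have h1 := hT₂ ((endTensorEquiv R (TruncPoly p a) (TruncPoly p b)).symm
      ((θ.conjAlgEquiv R).symm f))
    have h2 : (θ.conjAlgEquiv R) (endTensorEquiv R (TruncPoly p a) (TruncPoly p b)
      ((endTensorEquiv R (TruncPoly p a) (TruncPoly p b)).symm
      ((θ.conjAlgEquiv R).symm f))) ∈ T := h1
    rw [AlgEquiv.apply_symm_apply, AlgEquiv.apply_symm_apply] at h2
    exact h2
  have : Module.Free R Sᵐᵒᵖ := .of_equiv (MulOpposite.opLinearEquiv R (M := S))
  have : Module.Finite R Sᵐᵒᵖ := .equiv (MulOpposite.opLinearEquiv R (M := S))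
  have : Nontrivial S := Module.nontrivial_of_finrank_pos (R := R) (by
    rw [finrank_symbol]
    exact Nat.mul_pos (Fact.out : p.Prime).pos (Fact.out : p.Prime).pos)
  have : FaithfulSMul R S := inferInstance
  refine ⟨bijective_of_surjective_of_finrank_eq (AlgHom.mulLeftRight R S).toLinearMap hsurj ?_⟩
  rw [Module.finrank_tensorProduct, Module.finrank_linearMap,
    ← (MulOpposite.opLinearEquiv R (M := S)).finrank_eq]

end OnePair
/-! ### Brauer classes of symbol algebras -/

section BrauerClass

variable {R : Type u} [CommRing R]

theorem brauerClass_congr {A B : Type u} [Ring A] [Algebra R A] [IsAzumaya R A] [Ring B]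
    [Algebra R B] [IsAzumaya R B] (e : A ≃ₐ[R] B) : brauerClass R A = brauerClass R B :=
  Quotient.sound (s := brauerSetoid R) (BrauerEquiv.of_algEquiv (A := ⟨A⟩) (B := ⟨B⟩) e)

theorem brauerClass_mul (A B : Type u) [Ring A] [Algebra R A] [IsAzumaya R A] [Ring B]
    [Algebra R B] [IsAzumaya R B] [IsAzumaya R (A ⊗[R] B)] :
    brauerClass R A * brauerClass R B = brauerClass R (A ⊗[R] B) := rfl

theorem brauerClass_self : brauerClass R R = 1 := rfl

theorem brauerClass_eq_one_of_end {A : Type u} [Ring A] [Algebra R A] [IsAzumaya R A]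
    (V : Type u) [AddCommGroup V] [Module R V] [Module.Finite R V] [Module.Projective R V]
    [FaithfulSMul R V] (e : A ≃ₐ[R] Module.End R V) : brauerClass R A = 1 := by
  have e₀ : Module.End R R ≃ₐ[R] R :=
    (AlgEquiv.moduleEndSelf R (A := R)).symm.trans (AlgEquiv.toOpposite R R).symm
  exact Quotient.sound (s := brauerSetoid R) ⟨.unit, ⟨V⟩,
    ⟨((Algebra.TensorProduct.congr e e₀).trans (Algebra.TensorProduct.rid R R _)).trans
      (Algebra.TensorProduct.lid R _).symm⟩⟩

end BrauerClass

section SymbolClass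

variable {R : Type u} [CommRing R] (p : ℕ) [Fact p.Prime] [CharP R p]

instance [Nontrivial R] (a : R) : FaithfulSMul R (TruncPoly p a) := by
  have : Nontrivial (TruncPoly p a) := Module.nontrivial_of_finrank_pos (R := R) (by
    rw [finrank_truncPoly]; exact (Fact.out : p.Prime).pos)
  infer_instance

/-- The symbol algebra of `a, 0` is the endomorphism algebra of `R[X] / (X ^ p - a)`, with `x`
acting as `X` and `y` as `d/dX`. -/
theorem nonempty_symbol_zero_algEquiv [Nontrivial R] (a : R) :
    Nonempty (Symbol p a 0 ≃ₐ[R] Module.End R (TruncPoly p a)) := by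
  have h : IsSymbolSystem p (fun _ : Unit => a) (fun _ => 0) (fun _ => truncMul p a)
      (fun _ => truncDeriv p a) :=
    isSymbolSystem_unit (truncDeriv_mul_truncMul p a) (truncMul_pow p a)
      (by rw [truncDeriv_pow, map_zero])
  refine ⟨AlgEquiv.ofBijective h.lift (bijective_of_surjective_of_finrank_eq h.lift.toLinearMap
    (truncEnd_mem p a h.lift.range ⟨_, h.lift_symX ()⟩ ⟨_, h.lift_symY ()⟩) ?_)⟩
  rw [finrank_symbol, Module.finrank_linearMap, finrank_truncPoly]

/-- The Brauer class `[a, b)` of the symbol algebra of one pair. -/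
noncomputable def symbolClass [Nontrivial R] (a b : R) : Br R := brauerClass R (Symbol p a b)

theorem symbolClass_zero_right [Nontrivial R] (a : R) :
    symbolClass p a 0 = 1 := by
  obtain ⟨e⟩ := nonempty_symbol_zero_algEquiv p a
  exact brauerClass_eq_one_of_end _ e

/-- The change of variables `x ↦ -y`, `y ↦ x`. -/
noncomputable def symbolSwap (b : R) : Symbol p 0 b ≃ₐ[R] Symbol p b 0 :=
  have h₁ : IsSymbolSystem p (fun _ : Unit => (0 : R)) (fun _ => b)
      (fun _ => -genY p b 0) (fun _ => genX p b 0) :=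
    isSymbolSystem_unit (by rw [neg_mul, Symbol.yx b 0]; noncomm_ring)
      (by rw [neg_pow, genY_pow, map_zero, mul_zero]) (genX_pow p b 0)
  have h₂ : IsSymbolSystem p (fun _ : Unit => b) (fun _ => (0 : R))
      (fun _ => genY p 0 b) (fun _ => -genX p 0 b) :=
    isSymbolSystem_unit (by rw [mul_neg, Symbol.yx 0 b]; noncomm_ring)
      (genY_pow p 0 b) (by rw [neg_pow, genX_pow, map_zero, mul_zero])
  AlgEquiv.ofAlgHom h₁.lift h₂.lift
    (SymbolAlgebra.hom_ext (fun _ => by simp) (fun _ => by simp))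
    (SymbolAlgebra.hom_ext (fun _ => by simp) (fun _ => by simp))

theorem symbolClass_zero_left [Nontrivial R] (b : R) :
    symbolClass p 0 b = 1 :=
  (brauerClass_congr (symbolSwap p b)).trans (symbolClass_zero_right p b)

omit p [Fact p.Prime] [CharP R p] in
theorem commute_includes {A B : Type*} [Ring A] [Algebra R A] [Ring B] [Algebra R B] (a : A)
    (b : B) : Commute (a ⊗ₜ[R] (1 : B)) ((1 : A) ⊗ₜ[R] b) := by
  simp [Commute, SemiconjBy]

variable {p} in
/-- The shear `x, y + y', x' - x, y'` of two mutually commuting pairs. -/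
theorem isSymbolSystem_shear {A : Type*} [Ring A] [Algebra R A] {a b c b' : R} {x y x' y' : A}
    (h : IsSymbolSystem p (fun _ : Unit => a) (fun _ => b) (fun _ => x) (fun _ => y))
    (h' : IsSymbolSystem p (fun _ : Unit => c) (fun _ => b') (fun _ => x') (fun _ => y'))
    (hxx : Commute x x') (hxy : Commute x y') (hyx : Commute y x') (hyy : Commute y y') :
    IsSymbolSystem p (fun _ : Unit => a) (fun _ => b + b') (fun _ => x) (fun _ => y + y') ∧
    IsSymbolSystem p (fun _ : Unit => c - a) (fun _ => b') (fun _ => x' - x) (fun _ => y') ∧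
    Commute x (x' - x) ∧ Commute x y' ∧ Commute (y + y') (x' - x) ∧ Commute (y + y') y' := by
  have e : y * x = x * y + 1 := by simpa using h.yx () ()
  have e' : y' * x' = x' * y' + 1 := by simpa using h'.yx () ()
  refine ⟨isSymbolSystem_unit ?_ (h.xp ()) ?_, isSymbolSystem_unit ?_ ?_ (h'.yp ()),
    hxx.sub_right (Commute.refl x), hxy, ?_, hyy.add_left (Commute.refl y')⟩
  · rw [add_mul, mul_add, e, hxy.eq]; abel
  · rw [add_pow_of_commute_of_charP R hyy, h.yp (), h'.yp (), map_add]
  · rw [mul_sub, sub_mul, e', hxy.eq]; abel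
  · have hx : Commute (x' - x) x := hxx.symm.sub_left (Commute.refl x)
    have := add_pow_of_commute_of_charP (p := p) R hx
    rw [sub_add_cancel, h'.xp (), h.xp ()] at this
    rw [map_sub, this, add_sub_cancel_right]
  · change (y + y') * (x' - x) = (x' - x) * (y + y')
    rw [add_mul, mul_sub, mul_sub, e, e', hyx.eq, ← hxy.eq, sub_mul, mul_add, mul_add]
    abel

variable {p} in
/-- The shear `x, y - y', x' + x, y'` of two mutually commuting pairs; it is the inverse of
`isSymbolSystem_shear`. -/
theorem isSymbolSystem_shear_symm {A : Type*} [Ring A] [Algebra R A] {a b c b' : R}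
    {x y x' y' : A}
    (h : IsSymbolSystem p (fun _ : Unit => a) (fun _ => b) (fun _ => x) (fun _ => y))
    (h' : IsSymbolSystem p (fun _ : Unit => c) (fun _ => b') (fun _ => x') (fun _ => y'))
    (hxx : Commute x x') (hxy : Commute x y') (hyx : Commute y x') (hyy : Commute y y') :
    IsSymbolSystem p (fun _ : Unit => a) (fun _ => b - b') (fun _ => x) (fun _ => y - y') ∧
    IsSymbolSystem p (fun _ : Unit => c + a) (fun _ => b') (fun _ => x' + x) (fun _ => y') ∧
    Commute x (x' + x) ∧ Commute x y' ∧ Commute (y - y') (x' + x) ∧ Commute (y - y') y' := by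
  have e : y * x = x * y + 1 := by simpa using h.yx () ()
  have e' : y' * x' = x' * y' + 1 := by simpa using h'.yx () ()
  refine ⟨isSymbolSystem_unit ?_ (h.xp ()) ?_, isSymbolSystem_unit ?_ ?_ (h'.yp ()),
    hxx.add_right (Commute.refl x), hxy, ?_, hyy.sub_left (Commute.refl y')⟩
  · rw [sub_mul, mul_sub, e, hxy.eq]; abel
  · have hy : Commute (y - y') y' := hyy.sub_left (Commute.refl y')
    have := add_pow_of_commute_of_charP (p := p) R hy
    rw [sub_add_cancel, h.yp (), h'.yp ()] at this
    rw [map_sub, this, add_sub_cancel_right]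
  · rw [mul_add, add_mul, e', hxy.eq]; abel
  · rw [add_pow_of_commute_of_charP R hxx.symm, h.xp (), h'.xp (), map_add]
  · change (y - y') * (x' + x) = (x' + x) * (y - y')
    rw [sub_mul, mul_add, mul_add, e, e', hyx.eq, ← hxy.eq, add_mul, mul_sub, mul_sub]
    abel

/-- With `x₁, y₁, x₂, y₂` the generators on the left, the generators on the right are
`x₁, y₁ + y₂, x₂ - x₁, y₂`. -/
theorem nonempty_symbolAdd_algEquiv (a b b' : R) :
    Nonempty (Symbol p a b ⊗[R] Symbol p a b' ≃ₐ[R] Symbol p a (b + b') ⊗[R] Symbol p 0 b') := by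
  have s₁ : IsSymbolSystem p (fun _ : Unit => a) (fun _ => b)
      (fun _ => genX p a b ⊗ₜ[R] (1 : Symbol p a b')) (fun _ => genY p a b ⊗ₜ[R] 1) :=
    (isSymbolSystem_sym p _ _).map (Algebra.TensorProduct.includeLeft (S := R))
  have s₂ : IsSymbolSystem p (fun _ : Unit => a) (fun _ => b')
      (fun _ => (1 : Symbol p a b) ⊗ₜ[R] genX p a b') (fun _ => 1 ⊗ₜ[R] genY p a b') :=
    (isSymbolSystem_sym p _ _).map
      (Algebra.TensorProduct.includeRight (R := R) (A := Symbol p a b))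
  have t₁ : IsSymbolSystem p (fun _ : Unit => a) (fun _ => b + b')
      (fun _ => genX p a (b + b') ⊗ₜ[R] (1 : Symbol p 0 b'))
      (fun _ => genY p a (b + b') ⊗ₜ[R] 1) :=
    (isSymbolSystem_sym p _ _).map (Algebra.TensorProduct.includeLeft (S := R))
  have t₂ : IsSymbolSystem p (fun _ : Unit => (0 : R)) (fun _ => b')
      (fun _ => (1 : Symbol p a (b + b')) ⊗ₜ[R] genX p 0 b') (fun _ => 1 ⊗ₜ[R] genY p 0 b') :=
    (isSymbolSystem_sym p _ _).map
      (Algebra.TensorProduct.includeRight (R := R) (A := Symbol p a (b + b')))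
  obtain ⟨u₁, u₂, u₃, u₄, u₅, u₆⟩ := isSymbolSystem_shear_symm t₁ t₂
    (commute_includes _ _) (commute_includes _ _) (commute_includes _ _) (commute_includes _ _)
  obtain ⟨v₁, v₂, v₃, v₄, v₅, v₆⟩ := isSymbolSystem_shear s₁ s₂
    (commute_includes _ _) (commute_includes _ _) (commute_includes _ _) (commute_includes _ _)
  simp only [add_sub_cancel_right, zero_add, sub_self] at u₁ u₂ v₂
  refine ⟨AlgEquiv.ofAlgHom
    (u₁.tensorLift u₂ (fun _ _ => u₃) (fun _ _ => u₄) (fun _ _ => u₅) (fun _ _ => u₆))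
    (v₁.tensorLift v₂ (fun _ _ => v₃) (fun _ _ => v₄) (fun _ _ => v₅) (fun _ _ => v₆))
    (symbolTensor_hom_ext ?_ ?_ ?_ ?_) (symbolTensor_hom_ext ?_ ?_ ?_ ?_)⟩ <;>
  · rintro ⟨⟩
    simp [IsSymbolSystem.tensorLift]

/-- `b ↦ [a, b)` is additive. -/
theorem symbolClass_add [Nontrivial R] (a b b' : R) :
    symbolClass p a b * symbolClass p a b' = symbolClass p a (b + b') := by
  have := isAzumaya_tensor R (Symbol p a b) (Symbol p a b')
  have := isAzumaya_tensor R (Symbol p a (b + b')) (Symbol p 0 b')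
  obtain ⟨e⟩ := nonempty_symbolAdd_algEquiv p a b b'
  rw [symbolClass, symbolClass, brauerClass_mul, brauerClass_congr e, ← brauerClass_mul,
    ← symbolClass, ← symbolClass, symbolClass_zero_left, mul_one]

omit [Fact p.Prime] [CharP R p] in
theorem nonempty_symbolAlgebra_zero_algEquiv (a b : Fin 0 → R) :
    Nonempty (SymbolAlgebra p a b ≃ₐ[R] R) := by
  have h : IsSymbolSystem p a b (fun _ => (0 : R)) (fun _ => 0) :=
    ⟨fun i => i.elim0, fun i => i.elim0, fun i => i.elim0, fun i => i.elim0, fun i => i.elim0⟩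
  exact ⟨AlgEquiv.ofAlgHom h.lift (Algebra.ofId R _) (by ext)
    (SymbolAlgebra.hom_ext (fun i => i.elim0) (fun i => i.elim0))⟩

omit [Fact p.Prime] [CharP R p] in
/-- The first pair of generators splits off from a symbol algebra. -/
theorem nonempty_symbolAlgebra_succ_algEquiv {n : ℕ} (a b : Fin (n + 1) → R) :
    Nonempty (SymbolAlgebra p a b ≃ₐ[R] Symbol p (a 0) (b 0) ⊗[R]
      SymbolAlgebra p (fun i : Fin n => a i.succ) (fun i => b i.succ)) := by
  have s := isSymbolSystem_sym p a b
  have s₁ : IsSymbolSystem p (fun _ : Unit => a 0) (fun _ => b 0) (fun _ => symX p a b 0)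
      (fun _ => symY p a b 0) :=
    isSymbolSystem_unit (by simpa using s.yx 0 0) (s.xp 0) (s.yp 0)
  have s₂ : IsSymbolSystem p (fun i : Fin n => a i.succ) (fun i => b i.succ)
      (fun i => symX p a b i.succ) (fun i => symY p a b i.succ) :=
    ⟨fun i j => s.xx _ _, fun i j => s.yy _ _, fun i j => by simpa using s.yx i.succ j.succ,
      fun i => s.xp _, fun i => s.yp _⟩
  have t₁ := (isSymbolSystem_sym p (fun _ : Unit => a 0) (fun _ => b 0)).map
    (Algebra.TensorProduct.includeLeft (R := R) (S := R)
      (B := SymbolAlgebra p (fun i : Fin n => a i.succ) (fun i => b i.succ)))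
  have t₂ := (isSymbolSystem_sym p (fun i : Fin n => a i.succ) (fun i => b i.succ)).map
    (Algebra.TensorProduct.includeRight (R := R) (A := Symbol p (a 0) (b 0)))
  have t : IsSymbolSystem p a b
      (Fin.cons (symX p (fun _ => a 0) (fun _ => b 0) () ⊗ₜ[R] 1) fun i =>
        1 ⊗ₜ[R] symX p (fun i : Fin n => a i.succ) (fun i => b i.succ) i)
      (Fin.cons (symY p (fun _ => a 0) (fun _ => b 0) () ⊗ₜ[R] 1) fun i =>
        1 ⊗ₜ[R] symY p (fun i : Fin n => a i.succ) (fun i => b i.succ) i) := by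
    refine ⟨fun i j => ?_, fun i j => ?_, fun i j => ?_, fun i => ?_, fun i => ?_⟩
    · cases i using Fin.cases with
      | zero =>
        cases j using Fin.cases with
        | zero => rfl
        | succ j => exact commute_includes _ _
      | succ i =>
        cases j using Fin.cases with
        | zero => exact (commute_includes _ _).symm
        | succ j => exact t₂.xx i j
    · cases i using Fin.cases with
      | zero =>
        cases j using Fin.cases with
        | zero => rfl
        | succ j => exact commute_includes _ _
      | succ i =>
        cases j using Fin.cases with
        | zero => exact (commute_includes _ _).symm
        | succ j => exact t₂.yy i j
    · cases i using Fin.cases with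
      | zero =>
        cases j using Fin.cases with
        | zero => simpa using t₁.yx () ()
        | succ j =>
          rw [if_neg (Fin.succ_ne_zero j).symm, add_zero]
          exact commute_includes _ _
      | succ i =>
        cases j using Fin.cases with
        | zero =>
          rw [if_neg (Fin.succ_ne_zero i), add_zero]
          exact (commute_includes _ _).symm
        | succ j => simpa using t₂.yx i j
    · cases i using Fin.cases with
      | zero => exact t₁.xp ()
      | succ i => exact t₂.xp i
    · cases i using Fin.cases with
      | zero => exact t₁.yp ()
      | succ i => exact t₂.yp i
  have hne : ∀ i : Fin n, (0 : Fin (n + 1)) ≠ i.succ := fun i => (Fin.succ_ne_zero i).symm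
  refine ⟨AlgEquiv.ofAlgHom t.lift (s₁.tensorLift s₂ (fun _ _ => s.xx _ _) (fun _ j => ?_)
    (fun _ j => ?_) (fun _ _ => s.yy _ _))
    (symbolTensor_hom_ext ?_ ?_ ?_ ?_) (SymbolAlgebra.hom_ext ?_ ?_)⟩
  · have := s.yx j.succ 0
    rw [if_neg (hne j).symm, add_zero] at this
    exact this.symm
  · have := s.yx 0 j.succ
    rwa [if_neg (hne j), add_zero] at this
  · simp [IsSymbolSystem.tensorLift]
  · simp [IsSymbolSystem.tensorLift]
  · simp [IsSymbolSystem.tensorLift]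
  · simp [IsSymbolSystem.tensorLift]
  · intro i
    cases i using Fin.cases <;> simp [IsSymbolSystem.tensorLift]
  · intro i
    cases i using Fin.cases <;> simp [IsSymbolSystem.tensorLift]

/-- Symbol algebras are free and Azumaya, and the class is the product of the classes of the
pairs. -/
theorem symbolAlgebra_isAzumaya_brauerClass [Nontrivial R] {n : ℕ} (a b : Fin n → R) :
    Module.Free R (SymbolAlgebra p a b) ∧ ∃ _ : IsAzumaya R (SymbolAlgebra p a b),
      brauerClass R (SymbolAlgebra p a b) = ∏ i, symbolClass p (a i) (b i) := by
  induction n with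
  | zero =>
    obtain ⟨e⟩ := nonempty_symbolAlgebra_zero_algEquiv p a b
    have hA : IsAzumaya R (SymbolAlgebra p a b) := .of_AlgEquiv R _ _ e.symm
    exact ⟨.of_equiv e.symm.toLinearEquiv, hA, by
      rw [Fin.prod_univ_zero, brauerClass_congr e, brauerClass_self]⟩
  | succ n ih =>
    obtain ⟨e⟩ := nonempty_symbolAlgebra_succ_algEquiv p a b
    obtain ⟨_, _, h⟩ := ih (fun i => a i.succ) (fun i => b i.succ)
    have := isAzumaya_tensor R (Symbol p (a 0) (b 0))
      (SymbolAlgebra p (fun i : Fin n => a i.succ) (fun i => b i.succ))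
    have hA : IsAzumaya R (SymbolAlgebra p a b) := .of_AlgEquiv R _ _ e.symm
    exact ⟨.of_equiv e.symm.toLinearEquiv, hA, by
      rw [Fin.prod_univ_succ, brauerClass_congr e, ← brauerClass_mul, h, symbolClass]⟩

end SymbolClass
/-! ### The Weyl algebra as a symbol algebra -/

section WeylSymbol

variable (p n : ℕ) {k : Type u} [Field k] [CharP k p]

theorem algebraMap_weyl_C (c : k) :
    algebraMap (Coord n k) (Weyl p n k) (MvPolynomial.C c) = algebraMap k (WeylAlgebra n k) c := by
  change ((toCenter n k p (MvPolynomial.C c) : Subalgebra.center k (WeylAlgebra n k)) :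
    WeylAlgebra n k) = _
  rw [← MvPolynomial.algebraMap_eq, AlgHom.commutes]
  rfl

theorem algebraMap_omegaPush (c : kˣ) (r : Coord n k) :
    algebraMap (Coord n k) (OmegaPush p n c) r
      = algebraMap (Coord n k) (Weyl p n k) (omegaBar n c r) := rfl

theorem algebraMap_omegaPush_C (c : kˣ) (a : k) :
    algebraMap (Coord n k) (OmegaPush p n c) (MvPolynomial.C a)
      = algebraMap k (WeylAlgebra n k) a := by
  have h : omegaBar n c (MvPolynomial.C a) = MvPolynomial.C a := (omegaBar n c).commutes a
  rw [algebraMap_omegaPush, h]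
  exact algebraMap_weyl_C p n a

theorem algebraMap_omegaPush_X (c : kˣ) (i : Ind n) :
    algebraMap (Coord n k) (OmegaPush p n c) (MvPolynomial.X i)
      = algebraMap k (WeylAlgebra n k) ((c⁻¹ ^ omegaExp n i : kˣ) : k) * weylGen n k i ^ p := by
  rw [algebraMap_omegaPush, omegaBar_X, map_mul]
  exact congrArg₂ _ (algebraMap_weyl_C p n _) (algebraMap_X n k p i)

omit [CharP k p] in
theorem weylGen_mul (i j : Ind n) : weylGen n k i * weylGen n k j
    = weylGen n k j * weylGen n k i + algebraMap k _ (weylForm n k i j) := by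
  rw [← weylGen_comm]; abel

/-- In `ω(c)_* A_n(k)` one has `x_i ^ p = z_i` and `x_{n+i} ^ p = c z_{n+i}`. -/
theorem isSymbolSystem_omegaPush (c : kˣ) :
    IsSymbolSystem (A := OmegaPush p n c) p
      (fun i : Fin n => (MvPolynomial.X (.inl i) : Coord n k))
      (fun i => MvPolynomial.C (c : k) * MvPolynomial.X (.inr i))
      (fun i => weylGen n k (.inl i)) (fun i => weylGen n k (.inr i)) where
  xx i j := by
    have h := weylGen_mul n (k := k) (.inl i) (.inl j)
    rw [show weylForm n k (.inl i) (.inl j) = 0 from rfl, map_zero, add_zero] at h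
    exact h
  yy i j := by
    have h := weylGen_mul n (k := k) (.inr i) (.inr j)
    rw [show weylForm n k (.inr i) (.inr j) = 0 from rfl, map_zero, add_zero] at h
    exact h
  yx i j := by
    have h := weylGen_mul n (k := k) (.inr i) (.inl j)
    rw [show weylForm n k (.inr i) (.inl j) = if i = j then 1 else 0 from rfl,
      apply_ite (algebraMap k _), map_one, map_zero] at h
    exact h
  xp i := by
    rw [algebraMap_omegaPush_X]
    simp only [omegaExp, pow_zero, Units.val_one, map_one, one_mul]
    rfl
  yp i := by
    have h : algebraMap k (WeylAlgebra n k) (c : k) *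
        (algebraMap k (WeylAlgebra n k) ((c⁻¹ ^ omegaExp n (.inr i) : kˣ) : k)
          * weylGen n k (.inr i) ^ p) = weylGen n k (.inr i) ^ p := by
      rw [← mul_assoc, ← map_mul]
      simp [omegaExp]
    rw [map_mul, algebraMap_omegaPush_C, algebraMap_omegaPush_X]
    exact h.symm

/-- `ω(c)_* A_n(k)` is the symbol algebra of `(z_1, …, z_n)` and `(c z_{n+1}, …, c z_{2n})`. -/
theorem nonempty_symbolAlgebra_algEquiv_omegaPush (c : kˣ) :
    Nonempty (SymbolAlgebra p (fun i : Fin n => (MvPolynomial.X (.inl i) : Coord n k))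
      (fun i => MvPolynomial.C (c : k) * MvPolynomial.X (.inr i))
        ≃ₐ[Coord n k] OmegaPush p n c) := by
  let S := SymbolAlgebra p (fun i : Fin n => (MvPolynomial.X (.inl i) : Coord n k))
      (fun i => MvPolynomial.C (c : k) * MvPolynomial.X (.inr i))
  have s := isSymbolSystem_sym p (fun i : Fin n => (MvPolynomial.X (.inl i) : Coord n k))
      (fun i => MvPolynomial.C (c : k) * MvPolynomial.X (.inr i))
  have t := isSymbolSystem_omegaPush p n c
  let _ : Algebra k S := ((algebraMap (Coord n k) S).comp MvPolynomial.C).toAlgebra'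
    fun r a => Algebra.commutes (MvPolynomial.C r : Coord n k) a
  have hk : ∀ a, algebraMap k S a = algebraMap (Coord n k) S (MvPolynomial.C a) := fun _ => rfl
  let γ : Ind n → S := Sum.elim (symX p _ _) (symY p _ _)
  -- the inverse comes from the presentation of the Weyl algebra over `k`
  let g : WeylAlgebra n k →ₐ[k] S := RingQuot.liftAlgHom k
    ⟨FreeAlgebra.lift k γ, by
      rintro _ _ ⟨i, j⟩
      simp only [map_sub, map_mul, FreeAlgebra.lift_ι_apply, AlgHom.commutes]
      rcases i with i | i <;> rcases j with j | j
      · simp only [γ, Sum.elim_inl, weylForm, map_zero, s.xx i j, sub_self]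
      · simp only [γ, Sum.elim_inl, Sum.elim_inr, weylForm, s.yx j i, eq_comm (a := i)]
        split_ifs <;> simp
      · simp only [γ, Sum.elim_inl, Sum.elim_inr, weylForm, s.yx i j]
        split_ifs <;> simp
      · simp only [γ, Sum.elim_inr, weylForm, map_zero, s.yy i j, sub_self]⟩
  have hg : ∀ i, g (weylGen n k i) = γ i := fun i =>
    (RingQuot.liftAlgHom_mkAlgHom_apply k _ _ _).trans (FreeAlgebra.lift_ι_apply _ _)
  have hgR : (g : WeylAlgebra n k →+* S).comp (algebraMap (Coord n k) (OmegaPush p n c))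
      = algebraMap (Coord n k) S := by
    refine MvPolynomial.ringHom_ext (fun a => ?_) fun i => ?_
    · refine (congrArg g (algebraMap_omegaPush_C p n c a)).trans ?_
      rw [AlgHom.commutes, hk]
    · refine (congrArg g (algebraMap_omegaPush_X p n c i)).trans ?_
      rw [map_mul, map_pow, AlgHom.commutes, hg, hk]
      rcases i with i | i
      · refine (congrArg _ (s.xp i)).trans ?_
        simp [omegaExp, S]
      · refine (congrArg _ (s.yp i)).trans ?_
        rw [← map_mul, ← mul_assoc, ← map_mul]
        simp [omegaExp]
  refine ⟨AlgEquiv.ofBijective t.lift ⟨Function.LeftInverse.injective (g := g) fun s' => ?_, ?_⟩⟩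
  · induction s' using SymbolAlgebra.induction with
    | h1 => exact (congrArg g (map_one t.lift)).trans (map_one g)
    | hx i s' hs =>
      rw [map_mul, t.lift_symX]
      refine (map_mul g _ _).trans ?_
      rw [hg, hs]
      rfl
    | hy i s' hs =>
      rw [map_mul, t.lift_symY]
      refine (map_mul g _ _).trans ?_
      rw [hg, hs]
      rfl
    | hadd s' t' hs ht =>
      rw [map_add]
      refine (map_add g _ _).trans ?_
      rw [hs, ht]
    | hsmul r s' hs =>
      rw [map_smul, Algebra.smul_def, Algebra.smul_def]
      refine (map_mul g _ _).trans ?_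
      rw [hs]
      exact congrArg (· * s') (RingHom.congr_fun hgR r)
  · change ∀ w : WeylAlgebra n k, ∃ a, t.lift a = w
    intro w
    induction w using weylGen_induction with
    | hk a =>
      exact ⟨algebraMap _ _ (MvPolynomial.C a),
        (AlgHom.commutes _ _).trans (algebraMap_omegaPush_C p n c a)⟩
    | hx i =>
      rcases i with i | i
      · exact ⟨_, t.lift_symX i⟩
      · exact ⟨_, t.lift_symY i⟩
    | hm a b ha hb =>
      obtain ⟨a', rfl⟩ := ha
      obtain ⟨b', rfl⟩ := hb
      exact ⟨a' * b', map_mul _ _ _⟩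
    | ha a b ha hb =>
      obtain ⟨a', rfl⟩ := ha
      obtain ⟨b', rfl⟩ := hb
      exact ⟨a' + b', map_add _ _ _⟩

theorem nonempty_omegaPush_one_algEquiv :
    Nonempty (OmegaPush p n (1 : kˣ) ≃ₐ[Coord n k] Weyl p n k) := by
  have h : ∀ r : Coord n k, omegaBar n (1 : kˣ) r = r := by
    intro r
    have : (omegaBar n (1 : kˣ)).toAlgHom = AlgHom.id k (Coord n k) := by
      refine MvPolynomial.algHom_ext fun i => ?_
      exact (omegaBar_X n 1 i).trans (by simp)
    exact AlgHom.congr_fun this r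
  exact ⟨{ RingEquiv.refl (Weyl p n k) with
    commutes' := fun r => congrArg (algebraMap (Coord n k) (Weyl p n k)) (h r) }⟩

variable [Fact p.Prime]

variable (k) in
theorem weyl_isAzumaya_free :
    Module.Free (Coord n k) (Weyl p n k) ∧ IsAzumaya (Coord n k) (Weyl p n k) := by
  obtain ⟨e⟩ := nonempty_symbolAlgebra_algEquiv_omegaPush p n (1 : kˣ)
  obtain ⟨f⟩ := nonempty_omegaPush_one_algEquiv p n (k := k)
  obtain ⟨hfree, hA, -⟩ := symbolAlgebra_isAzumaya_brauerClass p
    (fun i : Fin n => (MvPolynomial.X (.inl i) : Coord n k))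
    (fun i => MvPolynomial.C ((1 : kˣ) : k) * MvPolynomial.X (.inr i))
  exact ⟨.of_equiv (e.trans f).toLinearEquiv, .of_AlgEquiv _ _ _ (e.trans f)⟩

variable [IsAzumaya (Coord n k) (Weyl p n k)]

theorem brauerClass_omegaPush (c : kˣ) :
    brauerClass (Coord n k) (OmegaPush p n c) = ∏ i : Fin n,
      symbolClass p (MvPolynomial.X (.inl i) : Coord n k)
        (MvPolynomial.C (c : k) * MvPolynomial.X (.inr i)) := by
  obtain ⟨e⟩ := nonempty_symbolAlgebra_algEquiv_omegaPush p n c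
  obtain ⟨-, hA, h⟩ := symbolAlgebra_isAzumaya_brauerClass p
    (fun i : Fin n => (MvPolynomial.X (.inl i) : Coord n k))
    (fun i => MvPolynomial.C (c : k) * MvPolynomial.X (.inr i))
  rw [← h, brauerClass_congr e]

/-- The convention for `c = 0` agrees with the general formula, because the symbols of `z_i, 0` are
split. -/
theorem omegaClass_eq_prod (c : k) :
    omegaClass p n c = ∏ i : Fin n, symbolClass p (MvPolynomial.X (.inl i) : Coord n k)
      (MvPolynomial.C c * MvPolynomial.X (.inr i)) := by
  rw [omegaClass]
  split_ifs with h
  · subst h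
    have hne : Nonempty (Fin (p ^ n)) := ⟨⟨0, Nat.pow_pos (Fact.out : p.Prime).pos⟩⟩
    have hf : FaithfulSMul (Coord n k) (Fin (p ^ n) → Coord n k) := inferInstance
    simp only [map_zero, zero_mul, symbolClass_zero_right, Finset.prod_const_one]
    exact brauerClass_eq_one_of_end (Fin (p ^ n) → Coord n k)
      (Matrix.toLinAlgEquiv' (R := Coord n k))
  · exact brauerClass_omegaPush p n (Units.mk0 c h)

theorem omegaClass_mul (c c' : k) :
    omegaClass p n c * omegaClass p n c' = omegaClass p n (c + c') := by
  simp only [omegaClass_eq_prod, ← Finset.prod_mul_distrib, symbolClass_add, MvPolynomial.C_add,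
    add_mul]

theorem omegaClass_zero : omegaClass p n (0 : k) = 1 := by
  have h := omegaClass_mul p n (0 : k) 0
  rwa [add_zero, mul_eq_left] at h

theorem omegaClass_one :
    omegaClass p n (1 : k) = brauerClass (Coord n k) (Weyl p n k) := by
  obtain ⟨f⟩ := nonempty_omegaPush_one_algEquiv p n (k := k)
  rw [← brauerClass_congr f, omegaClass_eq_prod, brauerClass_omegaPush, Units.val_one]

theorem omegaClass_pow (c : k) (m : ℕ) :
    omegaClass p n c ^ m = omegaClass p n (m * c) := by
  induction m with
  | zero => rw [pow_zero, Nat.cast_zero, zero_mul, omegaClass_zero]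
  | succ m ih => rw [pow_succ, ih, omegaClass_mul, Nat.cast_succ, add_mul, one_mul]

theorem brauerClass_weyl_pow : brauerClass (Coord n k) (Weyl p n k) ^ p = 1 := by
  rw [← omegaClass_one, omegaClass_pow, CharP.cast_eq_zero, zero_mul, omegaClass_zero]

variable (k) in
/-- The center of an Azumaya algebra that is free as a module is the base ring. -/
theorem toCenter_bijective : Function.Bijective (toCenter n k p) := by
  have hfree := (weyl_isAzumaya_free p n k).1
  refine ⟨fun r s h => FaithfulSMul.algebraMap_injective (Coord n k) (Weyl p n k)
    (congrArg Subtype.val h), ?_⟩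
  rintro ⟨a, ha⟩
  have h : (show Weyl p n k from a) ∈ Subalgebra.center (Coord n k) (Weyl p n k) :=
    Subalgebra.mem_center_iff.2 fun b => Subalgebra.mem_center_iff.1 ha b
  obtain ⟨r, hr⟩ := Algebra.IsCentral.out h
  exact ⟨r, Subtype.ext hr⟩

end WeylSymbol
/-! ### Noncommutative domains have nontrivial Brauer class -/

section NontrivialClass

variable {R : Type u} [CommRing R] [IsDomain R]

theorem eq_zero_of_smul_eq_zero_of_projective {V : Type*} [AddCommGroup V] [Module R V]
    [Module.Projective R V] {r : R} (hr : r ≠ 0) {v : V} (h : r • v = 0) : v = 0 := by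
  rw [← Module.forall_dual_apply_eq_zero_iff R]
  intro φ
  have h1 := congrArg φ h
  rw [map_smul, map_zero, smul_eq_mul] at h1
  exact (mul_eq_zero.1 h1).resolve_left hr

omit [IsDomain R] in
theorem exists_dual_apply_ne_zero {V : Type*} [AddCommGroup V] [Module R V]
    [Module.Projective R V] {v : V} (hv : v ≠ 0) : ∃ ψ : V →ₗ[R] R, ψ v ≠ 0 := by
  by_contra! h
  exact hv ((Module.forall_dual_apply_eq_zero_iff R _).1 h)

/-- If every functional that does not vanish on the range of `E` is injective there, then the range
of `E` has rank at most one, so the operators commuting with `E` commute with each other on it. -/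
theorem apply_comm_of_rankOne {V : Type*} [AddCommGroup V] [Module R V]
    [Module.Projective R V] {E : Module.End R V}
    (hE : ∀ (ψ : V →ₗ[R] R) (v w : V), ψ (E v) ≠ 0 → E w ≠ 0 → ψ (E w) ≠ 0)
    {f g : Module.End R V} (hf : Commute f E) (hg : Commute g E) (v : V) :
    f (g (E v)) = g (f (E v)) := by
  by_cases hv : E v = 0
  · simp only [hv, map_zero]
  obtain ⟨ψ, hψ⟩ := exists_dual_apply_ne_zero (R := R) hv
  -- any two vectors of the range of `E` are proportional
  have hprop : ∀ u w, ψ (E w) • E u = ψ (E u) • E w := by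
    intro u w
    by_contra h
    have h1 : E (ψ (E w) • u - ψ (E u) • w) ≠ 0 := by
      rwa [map_sub, map_smul, map_smul, sub_ne_zero]
    refine hE ψ v _ hψ h1 ?_
    rw [map_sub, map_smul, map_smul, map_sub, map_smul, map_smul, smul_eq_mul, smul_eq_mul,
      mul_comm, sub_self]
  -- an operator commuting with `E` acts on its range by a scalar, up to the factor `ψ (E v)`
  have hscalar : ∀ h : Module.End R V, Commute h E → ∀ w,
      ψ (E v) • h (E w) = ψ (E (h v)) • E w := by
    intro h hh w
    rw [← map_smul, hprop w v, map_smul, ← hprop (h v) w]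
    exact congrArg _ (LinearMap.congr_fun hh.eq v)
  have key : ∀ f g : Module.End R V, Commute f E → Commute g E →
      ψ (E v) • ψ (E v) • f (g (E v)) = (ψ (E (g v)) * ψ (E (f v))) • E v := by
    intro f g hf hg
    rw [← map_smul f, hscalar g hg, map_smul, smul_comm, hscalar f hf, smul_smul]
  rw [← sub_eq_zero]
  refine eq_zero_of_smul_eq_zero_of_projective hψ (eq_zero_of_smul_eq_zero_of_projective hψ ?_)
  rw [smul_sub, smul_sub, key f g hf hg, key g f hg hf, mul_comm, sub_self]

/-- An Azumaya algebra without zero divisors that is not commutative is not split. If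
`A ⊗ End W ≅ End V`, let `E` be the endomorphism of `V` given by `1 ⊗ e`, where `e = φ(·) w` with
`φ(w) ≠ 0`. Then `E (End V) E` lies in `A ⊗ e`, so nonzero elements of it have nonzero products.
Hence `E` has rank one, and `A` acts commutatively on its range. -/
theorem brauerClass_ne_one_of_noZeroDivisors {A : Type u} [Ring A] [Algebra R A] [IsAzumaya R A]
    [NoZeroDivisors A] {a b : A} (hab : a * b ≠ b * a) : brauerClass R A ≠ 1 := by
  intro h
  obtain ⟨⟨W⟩, ⟨V⟩, ⟨Θ₀⟩⟩ : BrauerEquiv (⟨A⟩ : AzumayaAlgebra R) ⟨R⟩ :=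
    Quotient.exact (s := brauerSetoid R) h
  let Θ : A ⊗[R] Module.End R W ≃ₐ[R] Module.End R V :=
    Θ₀.trans (Algebra.TensorProduct.lid R _)
  obtain ⟨w, hw⟩ : ∃ w : W, w ≠ 0 := by
    by_contra! h
    exact one_ne_zero (FaithfulSMul.eq_of_smul_eq_smul (M := R) (α := W) fun w => by simp [h w])
  obtain ⟨φ, ht⟩ := exists_dual_apply_ne_zero (R := R) hw
  let e : Module.End R W := φ.smulRight w
  have he : ∀ g : Module.End R W, e * g * e = φ (g w) • e := by
    intro g
    ext x
    simp [e, smul_smul, mul_comm]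
  have hee : e * e = φ w • e := by simpa using he 1
  have hinj : ∀ c : A, c ⊗ₜ[R] e = 0 → c = 0 := by
    intro c hc
    have h1 := congrArg (TensorProduct.lift ((LinearMap.lsmul R A).flip.compl₂
      (φ ∘ₗ LinearMap.applyₗ w))) hc
    have h2 : φ w • φ w • c = 0 := by simpa [e, smul_smul] using h1
    exact eq_zero_of_smul_eq_zero_of_projective ht (eq_zero_of_smul_eq_zero_of_projective ht h2)
  let E := Θ (1 ⊗ₜ e)
  have hcorner : ∀ G : Module.End R V, ∃ c : A, E * G * E = Θ (c ⊗ₜ e) := by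
    intro G
    obtain ⟨z, rfl⟩ := Θ.surjective G
    simp only [E, ← map_mul]
    induction z with
    | zero => exact ⟨0, by simp⟩
    | add z z' hz hz' =>
      obtain ⟨c, hc⟩ := hz
      obtain ⟨c', hc'⟩ := hz'
      exact ⟨c + c', by rw [mul_add, add_mul, map_add, hc, hc', TensorProduct.add_tmul, map_add]⟩
    | tmul c g =>
      exact ⟨φ (g w) • c, by simp [he, TensorProduct.smul_tmul]⟩
  have hE2 : E * E = φ w • E := by
    simp only [E, ← map_mul, ← map_smul, Algebra.TensorProduct.tmul_mul_tmul, hee, mul_one,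
      TensorProduct.tmul_smul]
  have hprod : ∀ G G' : Module.End R V, E * G * E * (G' * E) = 0 →
      E * G * E = 0 ∨ E * G' * E = 0 := by
    intro G G' hGG
    obtain ⟨c, hc⟩ := hcorner G
    obtain ⟨c', hc'⟩ := hcorner G'
    have h1 : E * G * E * (E * G' * E) = 0 := by
      have : E * G * E * (E * G' * E) = E * G * (E * E) * (G' * E) := by noncomm_ring
      rw [this, hE2, mul_smul_comm, smul_mul_assoc, hGG, smul_zero]
    rw [hc, hc', ← map_mul, map_eq_zero_iff _ Θ.injective, Algebra.TensorProduct.tmul_mul_tmul,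
      hee, TensorProduct.tmul_smul, TensorProduct.smul_tmul'] at h1
    rcases mul_eq_zero.1 (eq_zero_of_smul_eq_zero_of_projective ht (hinj _ h1)) with h | h
    · left; rw [hc, h, TensorProduct.zero_tmul, map_zero]
    · right; rw [hc', h, TensorProduct.zero_tmul, map_zero]
  have hE : ∀ (ψ : V →ₗ[R] R) (v v' : V), ψ (E v) ≠ 0 → E v' ≠ 0 → ψ (E v') ≠ 0 := by
    intro ψ v v' hv hv' h0
    obtain ⟨χ, hχ⟩ := exists_dual_apply_ne_zero (R := R) hv'
    have happ : ∀ (ξ : V →ₗ[R] R) x, (E * ξ.smulRight v' * E) x = ξ (E x) • E v' := by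
      intro ξ x; simp
    rcases hprod (ψ.smulRight v') (χ.smulRight v') (by
      ext x
      rw [Module.End.mul_apply, happ]
      simp [h0]) with h | h
    · exact hv' (eq_zero_of_smul_eq_zero_of_projective hv
        ((happ ψ v).symm.trans (LinearMap.congr_fun h v)))
    · exact hv' (eq_zero_of_smul_eq_zero_of_projective hχ
        ((happ χ v').symm.trans (LinearMap.congr_fun h v')))
  have hcomm : ∀ c : A, Commute (Θ (c ⊗ₜ 1)) E := by
    intro c
    simp only [Commute, SemiconjBy, E, ← map_mul, Algebra.TensorProduct.tmul_mul_tmul, mul_one,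
      one_mul]
  have hzero : Θ ((a * b) ⊗ₜ e) = Θ ((b * a) ⊗ₜ e) := by
    have h1 : Θ (a ⊗ₜ 1) * (Θ (b ⊗ₜ 1) * E) = Θ (b ⊗ₜ 1) * (Θ (a ⊗ₜ 1) * E) :=
      LinearMap.ext (apply_comm_of_rankOne hE (hcomm a) (hcomm b))
    simpa only [E, ← map_mul, Algebra.TensorProduct.tmul_mul_tmul, mul_one, one_mul] using h1
  refine hab (sub_eq_zero.1 (hinj _ ?_))
  rw [TensorProduct.sub_tmul, Θ.injective hzero, sub_self]

end NontrivialClass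
/-! ### The Weyl algebra has no zero divisors -/

section Domain

open MvPolynomial

variable {k : Type u} [Field k]

section Degree

variable (σ : Type*) (k)

/-- Polynomials all of whose monomials have total degree less than `m`. -/
noncomputable def degreeLT (m : ℕ) : Submodule k (MvPolynomial σ k) :=
  restrictSupport k {s | s.degree < m}

variable {σ k}

theorem degreeLT_mono {m m' : ℕ} (h : m ≤ m') : degreeLT k σ m ≤ degreeLT k σ m' :=
  restrictSupport_mono k fun _ hs => lt_of_lt_of_le hs h

theorem monomial_mem_degreeLT {m : ℕ} {s : σ →₀ ℕ} (hs : s.degree < m) (c : k) :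
    monomial s c ∈ degreeLT k σ m := (monomial_mem_restrictSupport k).2 (.inl hs)

theorem degreeLT_le {m : ℕ} {N : Submodule k (MvPolynomial σ k)}
    (h : ∀ s : σ →₀ ℕ, s.degree < m → monomial s 1 ∈ N) : degreeLT k σ m ≤ N := by
  rw [degreeLT, restrictSupport_eq_span, Submodule.span_le]
  rintro _ ⟨s, hs, rfl⟩
  exact h s hs

theorem mul_mem_degreeLT {m m' : ℕ} {f g : MvPolynomial σ k} (hf : f ∈ degreeLT k σ (m + 1))
    (hg : g ∈ degreeLT k σ m') : f * g ∈ degreeLT k σ (m + m') := by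
  classical
  intro s hs
  obtain ⟨u, hu, v, hv, rfl⟩ := Finset.mem_add.1 (support_mul f g hs)
  have h1 : u.degree < m + 1 := hf hu
  have h2 : v.degree < m' := hg hv
  change (u + v).degree < m + m'
  rw [map_add]
  omega

theorem X_mem_degreeLT (i : σ) : (X i : MvPolynomial σ k) ∈ degreeLT k σ 2 :=
  monomial_mem_degreeLT (m := 2) (s := Finsupp.single i 1) (by simp) 1

theorem pderiv_mem_degreeLT (i : σ) {m : ℕ} {f : MvPolynomial σ k}
    (hf : f ∈ degreeLT k σ (m + 1)) : pderiv i f ∈ degreeLT k σ m := by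
  revert f
  change degreeLT k σ (m + 1) ≤ (degreeLT k σ m).comap (pderiv i).toLinearMap
  refine degreeLT_le fun s hs => ?_
  change pderiv i (monomial s 1) ∈ degreeLT k σ m
  rw [pderiv_monomial]
  by_cases h : s i = 0
  · simp [h]
  · refine monomial_mem_degreeLT ?_ _
    have h1 : s - Finsupp.single i 1 + Finsupp.single i 1 = s :=
      tsub_add_cancel_of_le (Finsupp.single_le_iff.2 (Nat.one_le_iff_ne_zero.2 h))
    have h2 := congrArg Finsupp.degree h1
    rw [map_add, Finsupp.degree_single] at h2
    omega

theorem mem_degreeLT_totalDegree (f : MvPolynomial σ k) :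
    f ∈ degreeLT k σ (f.totalDegree + 1) := fun _ hs => Nat.lt_succ_of_le (le_totalDegree hs)

theorem totalDegree_lt_of_mem {m : ℕ} {f : MvPolynomial σ k} (hf : f ≠ 0)
    (h : f ∈ degreeLT k σ m) : f.totalDegree < m := by
  obtain ⟨s, hs⟩ := support_nonempty.2 hf
  have hm : 0 < m := lt_of_le_of_lt (Nat.zero_le _) (h hs)
  exact (Finset.sup_lt_iff hm).2 fun s hs => h hs

end Degree

variable (n : ℕ)

/-- The derivation `∂/∂x_i` attached to the generator `x_{n+i}`, and zero for `x_i`. -/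
noncomputable def leftDeriv : Ind n → Derivation k (Coord n k) (Coord n k)
  | .inl _ => 0
  | .inr i => pderiv (.inl i)

/-- The derivation `∂/∂x_{n+i}` attached to the generator `x_i`, and zero for `x_{n+i}`. -/
noncomputable def rightDeriv : Ind n → Derivation k (Coord n k) (Coord n k)
  | .inl i => pderiv (.inr i)
  | .inr _ => 0

/-- Left multiplication by a generator on normally ordered monomials. -/
noncomputable def leftOp (i : Ind n) : Module.End k (Coord n k) :=
  LinearMap.mulLeft k (X i) + (leftDeriv n i).toLinearMap

/-- Right multiplication by a generator on normally ordered monomials. -/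
noncomputable def rightOp (i : Ind n) : Module.End k (Coord n k) :=
  LinearMap.mulLeft k (X i) + (rightDeriv n i).toLinearMap

theorem leftOp_apply (i : Ind n) (f : Coord n k) : leftOp n i f = X i * f + leftDeriv n i f := rfl

theorem rightOp_apply (i : Ind n) (f : Coord n k) :
    rightOp n i f = X i * f + rightDeriv n i f := rfl

theorem pderiv_comm {σ : Type*} (i j : σ) (f : MvPolynomial σ k) :
    pderiv i (pderiv j f) = pderiv j (pderiv i f) := by
  have : ⁅(pderiv i : Derivation k (MvPolynomial σ k) (MvPolynomial σ k)),
      (pderiv j : Derivation k (MvPolynomial σ k) (MvPolynomial σ k))⁆ = 0 := by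
    classical
    refine MvPolynomial.derivation_ext fun l => ?_
    simp [Derivation.commutator_apply, pderiv_X, Pi.single_apply, apply_ite]
  have h := Derivation.congr_fun this f
  rwa [Derivation.commutator_apply, Derivation.zero_apply, sub_eq_zero] at h

theorem leftOp_comm (i j : Ind n) :
    leftOp n i * leftOp n j - leftOp n j * leftOp n i
      = algebraMap k (Module.End k (Coord n k)) (weylForm n k i j) := by
  classical
  refine LinearMap.ext fun f => ?_
  rcases i with i | i <;> rcases j with j | j <;>
    simp only [LinearMap.sub_apply, Module.End.mul_apply, leftOp_apply, leftDeriv, weylForm,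
      Derivation.zero_apply, Derivation.leibniz, map_add, pderiv_X, smul_eq_mul, map_zero,
      LinearMap.zero_apply, Pi.single_apply, Sum.inl.injEq, reduceCtorEq, if_false,
      pderiv_comm (Sum.inl i) (Sum.inl j)]
  · ring
  · by_cases h : i = j
    · subst h; simp; ring
    · simp [h]; ring
  · by_cases h : i = j
    · subst h; simp; ring
    · simp [h, Ne.symm h]; ring
  · ring

theorem leftOp_rightOp_comm (i j : Ind n) : Commute (leftOp (k := k) n i) (rightOp n j) := by
  classical
  refine LinearMap.ext fun f => ?_
  rcases i with i | i <;> rcases j with j | j <;>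
    simp only [Module.End.mul_apply, leftOp_apply, rightOp_apply, leftDeriv, rightDeriv,
      Derivation.zero_apply, Derivation.leibniz, map_add, pderiv_X, smul_eq_mul,
      Pi.single_apply, Sum.inl.injEq, Sum.inr.injEq, reduceCtorEq, if_false,
      pderiv_comm (Sum.inl i) (Sum.inr j)] <;>
    (try split_ifs) <;> (try simp_all) <;> ring

variable (k) in
/-- The left regular representation of the Weyl algebra on polynomials, which are regarded as
normally ordered expressions: `x_i` acts by multiplication and `x_{n+i}` by
`∂/∂x_i + x_{n+i}`. -/
noncomputable def weylRep : WeylAlgebra n k →ₐ[k] Module.End k (Coord n k) :=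
  RingQuot.liftAlgHom k ⟨FreeAlgebra.lift k (leftOp n), by
    rintro _ _ ⟨i, j⟩
    simp only [map_sub, map_mul, FreeAlgebra.lift_ι_apply, AlgHom.commutes]
    exact leftOp_comm n i j⟩

theorem weylRep_weylGen (i : Ind n) : weylRep k n (weylGen n k i) = leftOp n i :=
  (RingQuot.liftAlgHom_mkAlgHom_apply k _ _ _).trans (FreeAlgebra.lift_ι_apply _ _)

theorem weylRep_rightOp (a : WeylAlgebra n k) (j : Ind n) :
    Commute (weylRep k n a) (rightOp n j) := by
  induction a using weylGen_induction with
  | hk c => rw [AlgHom.commutes]; exact Algebra.commutes c _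
  | hx i => rw [weylRep_weylGen]; exact leftOp_rightOp_comm n i j
  | hm a b h h' => rw [map_mul]; exact h.mul_left h'
  | ha a b h h' => rw [map_add]; exact h.add_left h'

theorem rightDeriv_mem_degreeLT (i : Ind n) {m : ℕ} {f : Coord n k}
    (hf : f ∈ degreeLT k (Ind n) (m + 1)) : rightDeriv n i f ∈ degreeLT k (Ind n) m := by
  cases i with
  | inl i => exact pderiv_mem_degreeLT _ hf
  | inr i => exact zero_mem _

/-- Induction on the degree with right multiplications in place of multiplications by variables; the
two differ by terms of lower degree. -/
theorem degreeLT_le_of_rightOp (Q : ℕ → Submodule k (Coord n k)) (h1 : 1 ∈ Q 0)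
    (hmono : ∀ e, Q e ≤ Q (e + 1))
    (hstep : ∀ e, ∀ f ∈ degreeLT k (Ind n) (e + 1), f ∈ Q e → ∀ i, rightOp n i f ∈ Q (e + 1))
    (e : ℕ) : degreeLT k (Ind n) (e + 1) ≤ Q e := by
  induction e with
  | zero =>
    refine degreeLT_le fun s hs => ?_
    have : s = 0 := s.degree_eq_zero_iff.1 (by omega)
    subst this
    exact h1
  | succ e ih =>
    refine degreeLT_le fun s hs => ?_
    by_cases h0 : s = 0
    · subst h0
      exact hmono e (ih (monomial_mem_degreeLT (by simp) 1))
    obtain ⟨i, hi⟩ := Finsupp.ne_iff.1 h0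
    have hs' : s - Finsupp.single i 1 + Finsupp.single i 1 = s :=
      tsub_add_cancel_of_le (Finsupp.single_le_iff.2 (Nat.one_le_iff_ne_zero.2 hi))
    have hd := congrArg Finsupp.degree hs'
    rw [map_add, Finsupp.degree_single] at hd
    let f : Coord n k := monomial (s - Finsupp.single i 1) 1
    have hf : f ∈ degreeLT k (Ind n) (e + 1) := monomial_mem_degreeLT (by omega) 1
    have hX : monomial s 1 = rightOp n i f - rightDeriv n i f := by
      rw [rightOp_apply, add_sub_cancel_right]
      simp only [f, X, monomial_mul, mul_one]
      rw [add_comm, hs']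
    rw [hX]
    exact sub_mem (hstep e f hf (ih hf) i)
      (hmono e (ih (degreeLT_mono (Nat.le_succ e) (rightDeriv_mem_degreeLT n i hf))))

/-- The right multiplications generate all polynomials from `1` and commute with the representation,
so an element that annihilates `1` acts as zero. -/
theorem weylRep_eq_zero {a : WeylAlgebra n k} (h : weylRep k n a 1 = 0) : weylRep k n a = 0 := by
  refine LinearMap.ext fun f => ?_
  refine degreeLT_le_of_rightOp n (fun _ => LinearMap.ker (weylRep k n a)) h (fun _ => le_rfl)
    (fun e f _ hf i => ?_) _ (mem_degreeLT_totalDegree f)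
  rw [LinearMap.mem_ker] at hf ⊢
  have := LinearMap.congr_fun (weylRep_rightOp n a i).eq f
  rw [Module.End.mul_apply, Module.End.mul_apply, hf, map_zero] at this
  exact this

/-- The leading form of a product in the Weyl algebra is the product of the leading forms. -/
theorem weylRep_sub_mem (a : WeylAlgebra n k) {d : ℕ}
    (hd : weylRep k n a 1 ∈ degreeLT k (Ind n) (d + 1)) (e : ℕ) {g : Coord n k}
    (hg : g ∈ degreeLT k (Ind n) (e + 1)) :
    weylRep k n a g - weylRep k n a 1 * g ∈ degreeLT k (Ind n) (d + e) := by
  set f := weylRep k n a 1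
  let Δ : Module.End k (Coord n k) := weylRep k n a - LinearMap.mulLeft k f
  revert g
  change degreeLT k (Ind n) (e + 1) ≤ (degreeLT k (Ind n) (d + e)).comap Δ
  refine degreeLT_le_of_rightOp n (fun e => (degreeLT k (Ind n) (d + e)).comap Δ) ?_
    (fun e => Submodule.comap_mono (degreeLT_mono (Nat.le_succ _))) (fun e g hg hΔ i => ?_) e
  · have : Δ 1 = 0 := by simp [Δ, f]
    exact Submodule.mem_comap.2 (this ▸ zero_mem _)
  · have h1 : weylRep k n a (rightOp n i g) = rightOp n i (weylRep k n a g) :=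
      LinearMap.congr_fun (weylRep_rightOp n a i).eq g
    have h2 : Δ (rightOp n i g)
        = rightOp n i (Δ g) + (rightDeriv n i (f * g) - f * rightDeriv n i g) := by
      simp only [Δ, LinearMap.sub_apply, LinearMap.mulLeft_apply, h1, map_sub]
      simp only [rightOp_apply]
      ring
    have hfg : f * g ∈ degreeLT k (Ind n) (d + (e + 1)) := mul_mem_degreeLT hd hg
    have hΔ' : Δ g ∈ degreeLT k (Ind n) (d + e) := hΔ
    refine Submodule.mem_comap.2 ?_
    rw [h2]
    refine add_mem ?_ (sub_mem ?_ ?_)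
    · rw [rightOp_apply]
      refine add_mem ?_ (rightDeriv_mem_degreeLT n i (degreeLT_mono (by omega) hΔ'))
      exact degreeLT_mono (by omega) (mul_mem_degreeLT (X_mem_degreeLT i) hΔ')
    · exact rightDeriv_mem_degreeLT n i (degreeLT_mono (by omega) hfg)
    · exact degreeLT_mono (by omega) (mul_mem_degreeLT hd (rightDeriv_mem_degreeLT n i hg))

theorem leftDeriv_expand (p : ℕ) [CharP k p] (i : Ind n) (r : Coord n k) :
    leftDeriv n i (MvPolynomial.expand p r) = 0 := by
  induction r using MvPolynomial.induction_on with
  | C c => rw [MvPolynomial.expand_C]; exact (leftDeriv n i).map_algebraMap c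
  | add r s hr hs => rw [map_add, map_add, hr, hs, add_zero]
  | mul_X r j hr =>
    rw [map_mul, Derivation.leibniz, hr, MvPolynomial.expand_X, Derivation.leibniz_pow]
    simp [CharP.cast_eq_zero]

/-- The central element `x_i ^ p` acts on `1` as the polynomial `x_i ^ p`. -/
theorem weylRep_algebraMap (p : ℕ) [CharP k p] (r : Coord n k) :
    weylRep k n (algebraMap (Coord n k) (Weyl p n k) r) 1 = MvPolynomial.expand p r := by
  have hD : ∀ i : Ind n, leftDeriv n i (X i : Coord n k) = 0 := by
    rintro (i | i)
    · rfl
    · simp [leftDeriv, pderiv_X]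
  have hpow : ∀ (i : Ind n) (f : Coord n k), leftDeriv n i f = 0 → ∀ m : ℕ,
      (leftOp n i ^ m) f = X i ^ m * f := by
    intro i f hf m
    induction m with
    | zero => simp
    | succ m ih =>
      rw [pow_succ', Module.End.mul_apply, ih, leftOp_apply, Derivation.leibniz, hf,
        Derivation.leibniz_pow, hD]
      simp [pow_succ', mul_assoc]
  induction r using MvPolynomial.induction_on with
  | C c =>
    rw [MvPolynomial.expand_C]
    refine (congrArg (fun u => weylRep k n u 1) (algebraMap_weyl_C p n c)).trans ?_
    rw [AlgHom.commutes, Module.algebraMap_end_apply, MvPolynomial.smul_eq_C_mul, mul_one]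
  | add r s hr hs =>
    rw [map_add, map_add, ← hr, ← hs]
    exact congrArg (fun u : Module.End k (Coord n k) => u 1) (map_add (weylRep k n) _ _)
  | mul_X r i hr =>
    rw [mul_comm, map_mul, map_mul, MvPolynomial.expand_X, algebraMap_X]
    refine (congrArg (fun u : Module.End k (Coord n k) => u 1)
      (map_mul (weylRep k n) _ _)).trans ?_
    rw [Module.End.mul_apply, hr, map_pow, weylRep_weylGen,
      hpow i _ (leftDeriv_expand n p i r)]

/-- The regular representation is faithful: its kernel is an ideal of an Azumaya algebra, so it is
stable under all `k[z]`-linear endomorphisms and meets `k[z]`, on which the representation is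
injective. -/
theorem weylRep_injective (p : ℕ) [Fact p.Prime] [CharP k p] :
    Function.Injective (weylRep k n) := by
  refine (injective_iff_map_eq_zero _).2 fun a ha => ?_
  obtain ⟨-, hA⟩ := weyl_isAzumaya_free p n k
  change (show Weyl p n k from a) = 0
  rw [← Module.forall_dual_apply_eq_zero_iff (Coord n k)]
  intro φ
  let J : AddSubgroup (Weyl p n k) := (weylRep k n).toRingHom.toAddMonoidHom.ker
  have hJ : ∀ t, AlgHom.mulLeftRight (Coord n k) (Weyl p n k) t (show Weyl p n k from a) ∈ J := by
    intro t
    induction t with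
    | zero => rw [map_zero]; exact zero_mem J
    | add t t' h h' => rw [map_add]; exact add_mem h h'
    | tmul u v =>
      rw [AlgHom.mulLeftRight_apply]
      change weylRep k n (show WeylAlgebra n k from u * (show Weyl p n k from a) * v.unop) = 0
      refine (map_mul (weylRep k n) _ _).trans ?_
      refine (congrArg (· * _) (map_mul (weylRep k n) _ _)).trans ?_
      rw [ha, mul_zero, zero_mul]
  obtain ⟨t, ht⟩ := hA.bij.2 (φ.smulRight (1 : Weyl p n k))
  have h1 := hJ t
  rw [ht, LinearMap.smulRight_apply, ← Algebra.algebraMap_eq_smul_one] at h1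
  have h2 : weylRep k n (algebraMap (Coord n k) (Weyl p n k) (φ a)) = 0 := h1
  have h3 := weylRep_algebraMap n p (φ a)
  rw [h2, LinearMap.zero_apply] at h3
  exact (MvPolynomial.expand_eq_zero (Fact.out : p.Prime).pos).1 h3.symm

variable (k) in
theorem weyl_noZeroDivisors (p : ℕ) [Fact p.Prime] [CharP k p] :
    NoZeroDivisors (Weyl p n k) := by
  refine ⟨fun {a b} hab => ?_⟩
  by_contra! h
  have hne : ∀ c : WeylAlgebra n k, c ≠ 0 → weylRep k n c 1 ≠ 0 := fun c hc h0 =>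
    hc (weylRep_injective n p ((weylRep_eq_zero n h0).trans (map_zero _).symm))
  let f := weylRep k n a 1
  let g := weylRep k n b 1
  have hfg : weylRep k n a g = 0 := by
    have h1 : weylRep k n a * weylRep k n b = 0 :=
      (map_mul (weylRep k n) a b).symm.trans ((congrArg (weylRep k n) hab).trans (map_zero _))
    exact LinearMap.congr_fun h1 1
  have h2 := weylRep_sub_mem n a (mem_degreeLT_totalDegree f) g.totalDegree
    (mem_degreeLT_totalDegree g)
  rw [hfg, zero_sub, neg_mem_iff] at h2
  have h3 := totalDegree_lt_of_mem (mul_ne_zero (hne a h.1) (hne b h.2)) h2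
  rw [totalDegree_mul_of_isDomain (hne a h.1) (hne b h.2)] at h3
  exact lt_irrefl _ h3

end Domain
end WeylBrauer

theorem mainTheorem6 {k : Type u} [Field k] (p n : ℕ) [Fact p.Prime] [CharP k p]
    (hp : p ≠ 2) (hn : 0 < n) :
    -- `z_i ↦ x_i ^ p` identifies `k[z_1, …, z_{2n}]` with the center of `A_n(k)`
    Function.Bijective (WeylBrauer.toCenter n k p) ∧
    -- `A_n(k)` is Azumaya over its center, so that the Brauer classes below make sense
    ∃ _ : IsAzumaya (WeylBrauer.Coord n k) (WeylBrauer.Weyl p n k),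
      (∀ c c' : k, WeylBrauer.omegaClass p n c * WeylBrauer.omegaClass p n c'
        = WeylBrauer.omegaClass p n (c + c')) ∧
      orderOf (WeylBrauer.brauerClass (WeylBrauer.Coord n k) (WeylBrauer.Weyl p n k)) = p := by
  have hA := (WeylBrauer.weyl_isAzumaya_free p n k).2
  refine ⟨WeylBrauer.toCenter_bijective p n k, hA, WeylBrauer.omegaClass_mul p n,
    orderOf_eq_prime (WeylBrauer.brauerClass_weyl_pow p n) ?_⟩
  have := WeylBrauer.weyl_noZeroDivisors k n p
  let y : WeylBrauer.Weyl p n k := WeylBrauer.weylGen n k (.inr ⟨0, hn⟩)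
  let x : WeylBrauer.Weyl p n k := WeylBrauer.weylGen n k (.inl ⟨0, hn⟩)
  have hyx : y * x - x * y = 1 := by
    refine (WeylBrauer.weylGen_comm n k _ _).trans ?_
    rw [show WeylBrauer.weylForm n k (.inr ⟨0, hn⟩) (.inl ⟨0, hn⟩) = 1 by
      simp [WeylBrauer.weylForm], map_one]
    rfl
  have hA1 : (1 : WeylBrauer.Weyl p n k) ≠ 0 := by
    intro h
    refine one_ne_zero (α := WeylBrauer.Coord n k)
      (FaithfulSMul.algebraMap_injective (WeylBrauer.Coord n k) (WeylBrauer.Weyl p n k) ?_)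
    rw [map_one, map_zero, h]
  exact WeylBrauer.brauerClass_ne_one_of_noZeroDivisors (a := y) (b := x) fun h =>
    hA1 (by rw [← hyx, h, sub_self])
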